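/- Let $d\ge 1$, let $A\in\mathbb R^{d\times d}$ be regular, $\Lambda=A\mathbb Z^d$, $\Lambda^*=A^{-T}\mathbb Z^d$, $V_\Lambda=|\det A|$, and let $|\cdot|$ be the Euclidean norm. For $x,y\in\mathbb R^d$ let $\nu\mapsto Z_{\Lambda,\nu}(x,y)$ be the meromorphic continuation to $\mathbb C$ of $$\sum_{z\in\Lambda,\;z\ne x}\frac{e^{-2\pi i\,y\cdot z}}{|x-z|^{\nu}},\qquad \operatorname{Re}\nu>d .$$ For $y\in\mathbb R^d\setminus\{0\}$ put $$\hat s_\nu(y)=\frac{\pi^{\nu/2}}{\Gamma(\nu/2)}\,\Gamma\Big(\frac{d-\nu}2\Big)(\pi|y|^2)^{(\nu-d)/2}\quad(\nu\notin d+2\mathbb N_0),$$ $$\hat s_{d+2k}(y)=\frac{\pi^{k+d/2}}{\Gamma(k+d/2)}\,\frac{(-1)^{k+1}}{k!}\,(\pi|y|^2)^k\log(\pi|y|^2)\quad(k\in\mathbb N_0),$$ where $1/\Gamma$ denotes the entire reciprocal gamma function. For $x\in\mathbb R^d$, $\nu\in\mathbb C$ and $y\in(\mathbb R^d\setminus\Lambda^*)\cup\{0\}$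 the regularised Epstein zeta function is $$Z^{\mathrm{reg}}_{\Lambda,\nu}(x,y)=e^{2\pi i\,x\cdot y}Z_{\Lambda,\nu}(x,y)-\frac1{V_\Lambda}\hat s_\nu(y)\quad(y\ne0),$$ continuously extended to $y=0$. For $L\subseteq\mathbb R^d$ let $$D_L=\{u\in\mathbb C^d:\ |\operatorname{Re}u-z|>|\operatorname{Im}u|\ \text{ for all } z\in L\}.$$ **Theorem (Holomorphy of the regularised Epstein zeta function).** The following hold, the sets named in 1--3 being open. 1. The function $(\nu,x,y)\mapsto Z^{\mathrm{reg}}_{\Lambda,\nu}(x,y)$, given for $\nu\in\mathbb C\setminus(d+2\mathbb N_0)$, $x\in\mathbb R^d\setminus\Lambda$, $y\in(\mathbb R^d\setminus\Lambda^*)\cup\{0\}$, extends to a jointly holomorphic function on $$\big(\mathbb C\setminus(d+2\mathbb N_0)\big)\times D_\Lambda\times D_{\Lambda^*\setminus\{0\}} .$$ 2. For every fixed $\nu\in d+2\mathbb N_0$, the function $(x,y)\mapsto Z^{\mathrm{reg}}_{\Lambda,\nu}(x,y)$, given for $x\in\mathbb R^d\setminus\Lambda$, $y\in(\mathbb R^d\setminus\Lambda^*)\cup\{0\}$,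 extends to a jointly holomorphic function on $D_\Lambda\times D_{\Lambda^*\setminus\{0\}}$. 3. For every fixed $x\in\Lambda$, the function $(\nu,y)\mapsto Z^{\mathrm{reg}}_{\Lambda,\nu}(x,y)$, given for $\nu\in\mathbb C\setminus(d+2\mathbb N_0)$, $y\in(\mathbb R^d\setminus\Lambda^*)\cup\{0\}$, extends to a jointly holomorphic function on $\big(\mathbb C\setminus(d+2\mathbb N_0)\big)\times D_{\Lambda^*\setminus\{0\}}$. 4. In particular, for $\nu\in\mathbb C$ and $x\in\mathbb R^d$ with $\nu\notin d+2\mathbb N_0$ or $x\notin\Lambda$, the function $y\mapsto Z^{\mathrm{reg}}_{\Lambda,\nu}(x,y)$ extends holomorphically to an open neighbourhood in $\mathbb C^d$ of the elementary reciprocal cell $A^{-T}[-1/2,1/2)^d$ and of the Brillouin zone $\{y\in\mathbb R^d:|y|\le|y-k|\ \text{for all } k\in\Lambda^*\}$; so it is analytic around $y=0$. -/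

import Mathlib

noncomputable section

namespace Epstein

/-- Real `d`-space and complex `d`-space, both with the Euclidean norm. -/
abbrev RSpace (d : ℕ) : Type := EuclideanSpace ℝ (Fin d)

abbrev CSpace (d : ℕ) : Type := EuclideanSpace ℂ (Fin d)

/-- The inclusion of real `d`-space into complex `d`-space. -/
def ofRealVec {d : ℕ} (x : RSpace d) : CSpace d := WithLp.toLp 2 fun i => (x i : ℂ)

/-- Component-wise real part. -/
def reVec {d : ℕ} (u : CSpace d) : RSpace d := WithLp.toLp 2 fun i => (u i).re

/-- Component-wise imaginary part. -/
def imVec {d : ℕ} (u : CSpace d) : RSpace d := WithLp.toLp 2 fun i => (u i).im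

/-- The lattice `A ℤ^d`. -/
def lattice {d : ℕ} (A : Matrix (Fin d) (Fin d) ℝ) : Set (RSpace d) :=
  Set.range fun n : Fin d → ℤ => WithLp.toLp 2 (A.mulVec fun i => (n i : ℝ))

/-- The reciprocal lattice `A^{-T} ℤ^d`. -/
def reciprocalLattice {d : ℕ} (A : Matrix (Fin d) (Fin d) ℝ) : Set (RSpace d) :=
  lattice (A⁻¹).transpose

/-- The elementary cell `A^{-T} [-1/2, 1/2)^d` of the reciprocal lattice. -/
def reciprocalCell {d : ℕ} (A : Matrix (Fin d) (Fin d) ℝ) : Set (RSpace d) :=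
  {y | ∃ t : Fin d → ℝ, (∀ i, t i ∈ Set.Ico (-(1 / 2) : ℝ) (1 / 2)) ∧
    y = WithLp.toLp 2 ((A⁻¹).transpose.mulVec t)}

/-- The (closed, first) Brillouin zone: the points that are at least as close to `0` as to
any other point of the reciprocal lattice. -/
def brillouinZone {d : ℕ} (A : Matrix (Fin d) (Fin d) ℝ) : Set (RSpace d) :=
  {y | ∀ k ∈ reciprocalLattice A, ‖y‖ ≤ ‖y - k‖}

/-- The intersection `D_L` of the complex cones with origins at the points of `L`. -/
def coneDomain {d : ℕ} (L : Set (RSpace d)) : Set (CSpace d) :=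
  {u | ∀ z ∈ L, ‖imVec u‖ < ‖reVec u - z‖}

/-- The lattice sum `∑' exp (-2 π i y ⬝ z) / |x - z| ^ ν` over all lattice points `z ≠ x`;
it converges absolutely for `Re ν > d`. -/
def latticeSum {d : ℕ} (A : Matrix (Fin d) (Fin d) ℝ) (x y : RSpace d) (ν : ℂ) : ℂ :=
  ∑' z : ↥(lattice A \ {x}),
    Complex.exp (-2 * Real.pi * Complex.I * (inner ℝ y (z : RSpace d) : ℝ)) /
      (‖x - (z : RSpace d)‖ : ℂ) ^ ν

/-- `g` is the meromorphic continuation to `ℂ` of the restriction of `f` to the half-plane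
`Re s > c`. The normal form fixes the values of `g`: it is analytic wherever its singularity is
removable, and it has the value `0` at its poles. By the identity theorem `g` is unique. -/
def IsMeromorphicContinuation (c : ℝ) (f g : ℂ → ℂ) : Prop :=
  MeromorphicNFOn g Set.univ ∧ ∀ s : ℂ, c < s.re → g s = f s

open Classical in
/-- The meromorphic continuation to `ℂ` of the restriction of `f` to the half-plane
`Re s > c`. (It is set to `0` if there is no such continuation.) -/
def meromorphicContinuation (c : ℝ) (f : ℂ → ℂ) : ℂ → ℂ :=
  if h : ∃ g, IsMeromorphicContinuation c f g then h.choose else 0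

/-- The Epstein zeta function: the meromorphic continuation in `ν` of the lattice sum. -/
def epsteinZeta {d : ℕ} (A : Matrix (Fin d) (Fin d) ℝ) (ν : ℂ) (x y : RSpace d) : ℂ :=
  meromorphicContinuation d (latticeSum A x y) ν

/-- The set `d + 2 ℕ₀` of exceptional exponents. -/
def exceptionalExponents (d : ℕ) : Set ℂ := {ν | ∃ k : ℕ, ν = d + 2 * k}

/-- The Fourier transform of `|·| ^ (-ν)` at `y ≠ 0`, for `ν ∉ d + 2 ℕ₀`. -/
def sHatGeneric {d : ℕ} (ν : ℂ) (y : RSpace d) : ℂ :=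
  (Real.pi : ℂ) ^ (ν / 2) / Complex.Gamma (ν / 2) * Complex.Gamma ((d - ν) / 2) *
    ((Real.pi * ‖y‖ ^ 2 : ℝ) : ℂ) ^ ((ν - d) / 2)

/-- The chosen Fourier transform of `|·| ^ (-ν)` at `y ≠ 0`, for `ν = d + 2 k`. -/
def sHatExceptional {d : ℕ} (k : ℕ) (y : RSpace d) : ℂ :=
  (Real.pi : ℂ) ^ ((k : ℂ) + d / 2) / Complex.Gamma ((k : ℂ) + d / 2) *
    ((-1) ^ (k + 1) / (k.factorial : ℂ)) *
    (((Real.pi * ‖y‖ ^ 2) ^ k * Real.log (Real.pi * ‖y‖ ^ 2) : ℝ) : ℂ)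

open Classical in
/-- The Fourier transform of `|·| ^ (-ν)` at `y ≠ 0`, for all exponents `ν`. -/
def sHat {d : ℕ} (ν : ℂ) (y : RSpace d) : ℂ :=
  if h : ∃ k : ℕ, ν = d + 2 * k then sHatExceptional h.choose y else sHatGeneric ν y

/-- The Epstein zeta function with its singularity at `y = 0` subtracted, for `y ≠ 0`. The
volume of the elementary lattice cell is `|det A|`. -/
def epsteinZetaRegAway {d : ℕ} (A : Matrix (Fin d) (Fin d) ℝ) (ν : ℂ) (x y : RSpace d) : ℂ :=
  Complex.exp (2 * Real.pi * Complex.I * (inner ℝ x y : ℝ)) * epsteinZeta A ν x y -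
    1 / ((|A.det| : ℝ) : ℂ) * sHat ν y

open Classical in
/-- The regularised Epstein zeta function, for `y ∈ (ℝ^d \ Λ*) ∪ {0}`: its value at `y = 0` is
the limit as `y → 0`. -/
def epsteinZetaReg {d : ℕ} (A : Matrix (Fin d) (Fin d) ℝ) (ν : ℂ) (x y : RSpace d) : ℂ :=
  if y = 0 then Filter.limUnder (nhdsWithin (0 : RSpace d) {0}ᶜ) (epsteinZetaRegAway A ν x)
  else epsteinZetaRegAway A ν x y

/-- `F` is (jointly) holomorphic on the open set `U`. -/
def IsHolomorphicOn {E : Type*} [NormedAddCommGroup E] [NormedSpace ℂ E]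
    (F : E → ℂ) (U : Set E) : Prop :=
  IsOpen U ∧ DifferentiableOn ℂ F U

end Epstein

end

/-! The proof is Riemann's method for zeta functions, carried out with complex arguments. Write G(s,
w) for the integral of t^(s-1) e^(-πwt) over t > 1 (`upperGamma`). For Re s > d/2 with s = ν/2, Γ(s)
π^(-s) |x-z|^(-2s) is a Mellin integral of a Gaussian. Its part over t > 1 is G(s, |x-z|²); the part
over 0 < t < 1, summed over z, is transformed by Poisson summation and the inversion t ↦ 1/t into a
sum of G(d/2 - s, |y-k|²) over the reciprocal lattice. This is `Gamma_mul_latticeSum`. If y lies off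
the reciprocal lattice, the right-hand side, divided by Γ(s) π^(-s), is entire in ν, so it is the
continuation (`epsteinZeta_eq`).

To complexify x and y, replace |u-z|² by the bilinear square of u-z. Its real part is |Re u - z|² -
|Im u|², which is positive exactly on the cone with vertex z. There G decays like exp(-π Re w),
which beats the growth of complexified characters, so the sums converge locally normally and are
jointly holomorphic (`differentiableOn_gammaSum`).

At y = 0 only the reciprocal term k = 0 is singular. For generic ν the subtracted ŝ is the
corresponding complete gamma integral, so the difference is minus the lower one, a power series in w
= y·y with denominators s + n, where now s = (d-ν)/2 (`upperGamma_add_lowerGamma`). It is entire in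
w, and its poles in s are exactly the exponents d + 2n. At ν = d + 2k the limit s → -k turns the
pole into the logarithm in ŝ plus a multiple of w^k (`exists_upperGamma_neg_natCast`), and the
remainder is again entire in w. Continuity then forces the value at y = 0. -/

namespace Epstein

open Filter Topology Set Metric MeasureTheory

variable {d : ℕ}

/-! ### Lattices: discreteness and convergent sums -/

/-- The columns of a regular matrix as a basis of Euclidean space. -/
noncomputable def latticeBasis (B : Matrix (Fin d) (Fin d) ℝ) (hB : B.det ≠ 0) :
    Module.Basis (Fin d) ℝ (RSpace d) :=
  (Pi.basisFun ℝ (Fin d)).map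
    ((LinearMap.GeneralLinearGroup.generalLinearEquiv ℝ (Fin d → ℝ)
      (Matrix.GeneralLinearGroup.toLin (Matrix.GeneralLinearGroup.mkOfDetNeZero B hB))).trans
      (WithLp.linearEquiv 2 ℝ (Fin d → ℝ)).symm)

theorem latticeBasis_sum (B : Matrix (Fin d) (Fin d) ℝ) (hB : B.det ≠ 0) (c : Fin d → ℝ) :
    ∑ i, c i • latticeBasis B hB i = WithLp.toLp 2 (B.mulVec c) := by
  have h : ∑ i, c i • Pi.basisFun ℝ (Fin d) i = c := by
    simpa using (Pi.basisFun ℝ (Fin d)).sum_repr c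
  simp only [latticeBasis, Module.Basis.map_apply, ← map_smul, ← map_sum, h]
  rfl

theorem lattice_eq_span (B : Matrix (Fin d) (Fin d) ℝ) (hB : B.det ≠ 0) :
    lattice B = (Submodule.span ℤ (range (latticeBasis B hB)) : Set (RSpace d)) := by
  ext x
  rw [SetLike.mem_coe, Submodule.mem_span_range_iff_exists_fun]
  refine exists_congr fun c => ?_
  show WithLp.toLp 2 (B.mulVec fun i => (c i : ℝ)) = x ↔ _
  rw [← latticeBasis_sum B hB]
  simp [Int.cast_smul_eq_zsmul]

theorem zero_mem_lattice (B : Matrix (Fin d) (Fin d) ℝ) : (0 : RSpace d) ∈ lattice B :=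
  ⟨0, by ext; simp [Matrix.mulVec, dotProduct]⟩

theorem finite_lattice_inter (B : Matrix (Fin d) (Fin d) ℝ) (hB : B.det ≠ 0) {s : Set (RSpace d)}
    (hs : Bornology.IsBounded s) : (s ∩ lattice B).Finite := by
  rw [lattice_eq_span B hB]
  exact ZSpan.setFinite_inter _ hs

theorem summable_span_norm_sub_rpow (b : Module.Basis (Fin d) ℝ (RSpace d)) {r : ℝ}
    (hr : (d : ℝ) < r) (x : RSpace d) :
    Summable fun z : Submodule.span ℤ (range b) => ‖(z : RSpace d) - x‖ ^ (-r) := by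
  have hd : Module.finrank ℤ (Submodule.span ℤ (range b)) = d := by
    rw [ZLattice.rank ℝ, finrank_euclideanSpace_fin]
  refine ZLattice.summable_norm_sub_rpow (Submodule.span ℤ (range b)) (-r) ?_ x
  rw [hd]
  exact neg_lt_neg hr

theorem summable_lattice_norm_sub_rpow (B : Matrix (Fin d) (Fin d) ℝ) (hB : B.det ≠ 0)
    {L : Set (RSpace d)} (hL : L ⊆ lattice B) (x : RSpace d) {r : ℝ} (hr : (d : ℝ) < r) :
    Summable fun z : L => ‖(z : RSpace d) - x‖ ^ (-r) := by
  rw [lattice_eq_span B hB] at hL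
  have h := summable_span_norm_sub_rpow (latticeBasis B hB) hr x
  let φ : L → Submodule.span ℤ (range (latticeBasis B hB)) := fun z => ⟨z, hL z.2⟩
  have hφ : Function.Injective φ := fun z w hzw =>
    Subtype.ext (congrArg (fun q : Submodule.span ℤ _ => (q : RSpace d)) hzw)
  exact (h.comp_injective hφ :)

theorem summable_lattice_gaussian (B : Matrix (Fin d) (Fin d) ℝ) (hB : B.det ≠ 0)
    {L : Set (RSpace d)} (hL : L ⊆ lattice B) (a : ℝ) {c : ℝ} (hc : 0 < c) :
    Summable fun z : L => Real.exp (a * ‖(z : RSpace d)‖ - c * ‖(z : RSpace d)‖ ^ 2) := by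
  -- The constant is the exponential of the maximum of (a + d + 1) r - c r²; the extra d + 1 pays
  -- for the comparison with r^(-(d+1)), through log r ≤ r.
  have h := (summable_lattice_norm_sub_rpow B hB hL 0 (lt_add_one (d : ℝ))).mul_left
    (Real.exp ((a + (d + 1)) ^ 2 / (4 * c)))
  refine Summable.of_norm_bounded_eventually h ?_
  -- The origin is set aside because there the comparison term 0^(-(d+1)) has the value 0.
  have hfin : {z : L | (z : RSpace d) = 0}.Finite :=
    Set.Subsingleton.finite fun u hu v hv => Subtype.ext (hu.trans hv.symm)
  refine hfin.subset fun z hz => ?_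
  by_contra hz0
  refine hz ?_
  show ‖_‖ ≤ Real.exp _ * _
  have hpos : 0 < ‖(z : RSpace d)‖ := norm_pos_iff.2 hz0
  set r := ‖(z : RSpace d)‖
  rw [Real.norm_of_nonneg (Real.exp_pos _).le, sub_zero, Real.rpow_def_of_pos hpos, ← Real.exp_add,
    Real.exp_le_exp]
  have hlog : Real.log r ≤ r := (Real.log_le_sub_one_of_pos hpos).trans (by linarith)
  have h1 : (d + 1 : ℝ) * Real.log r ≤ (d + 1) * r := by gcongr
  have h2 : (a + (d + 1)) * r - c * r ^ 2 ≤ (a + (d + 1)) ^ 2 / (4 * c) := by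
    rw [le_div_iff₀ (by positivity)]
    nlinarith [sq_nonneg (a + (d + 1) - 2 * c * r)]
  linarith

/-! ### Complex cones and the bilinear square -/

theorem norm_reVec_le (u : CSpace d) : ‖reVec u‖ ≤ ‖u‖ := by
  rw [EuclideanSpace.norm_eq, EuclideanSpace.norm_eq]
  refine Real.sqrt_le_sqrt (Finset.sum_le_sum fun i _ => ?_)
  simpa [reVec] using pow_le_pow_left₀ (abs_nonneg _) (Complex.abs_re_le_norm (u i)) 2

theorem norm_imVec_le (u : CSpace d) : ‖imVec u‖ ≤ ‖u‖ := by
  rw [EuclideanSpace.norm_eq, EuclideanSpace.norm_eq]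
  refine Real.sqrt_le_sqrt (Finset.sum_le_sum fun i _ => ?_)
  simpa [imVec] using pow_le_pow_left₀ (abs_nonneg _) (Complex.abs_im_le_norm (u i)) 2

theorem reVec_sub (u v : CSpace d) : reVec (u - v) = reVec u - reVec v := by
  ext i; simp [reVec]

theorem imVec_sub (u v : CSpace d) : imVec (u - v) = imVec u - imVec v := by
  ext i; simp [imVec]

@[simp] theorem reVec_ofRealVec (x : RSpace d) : reVec (ofRealVec x) = x := by
  ext i; simp [reVec, ofRealVec]

@[simp] theorem imVec_ofRealVec (x : RSpace d) : imVec (ofRealVec x) = 0 := by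
  ext i; simp [imVec, ofRealVec]

/-- The cone conditions hold with a uniform gap near every point of the cone domain. -/
theorem exists_gap_of_mem_coneDomain (B : Matrix (Fin d) (Fin d) ℝ) (hB : B.det ≠ 0)
    {L : Set (RSpace d)} (hL : L ⊆ lattice B) {u₀ : CSpace d} (hu : u₀ ∈ coneDomain L) :
    ∃ η > 0, ∀ u ∈ ball u₀ η, ∀ z ∈ L, ‖imVec u‖ + η ≤ ‖reVec u - z‖ := by
  -- The distances to the points of L tend to infinity, so their minimum is attained and the strict
  -- inequality there yields a gap.
  have key : ∃ η > 0, ∀ z ∈ L, ‖imVec u₀‖ + η ≤ ‖reVec u₀ - z‖ := by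
    rcases L.eq_empty_or_nonempty with rfl | hne
    · exact ⟨1, one_pos, by simp⟩
    have : Nonempty L := hne.to_subtype
    have ht : Tendsto (fun z : L => ‖reVec u₀ - z‖) cofinite atTop := by
      refine tendsto_atTop.2 fun b => ?_
      have hfin := finite_lattice_inter B hB (isBounded_closedBall (x := reVec u₀) (r := b))
      refine (hfin.preimage (f := fun z : L => (z : RSpace d))
        Subtype.val_injective.injOn).subset fun z hz => ⟨?_, hL z.2⟩
      rw [mem_closedBall, dist_comm, dist_eq_norm]
      exact le_of_not_ge fun h => hz h
    obtain ⟨z₀, hz₀⟩ := ht.exists_forall_le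
    refine ⟨‖reVec u₀ - z₀‖ - ‖imVec u₀‖, sub_pos.2 (hu z₀ z₀.2), fun z hz => ?_⟩
    linarith [hz₀ ⟨z, hz⟩]
  obtain ⟨η, hη, h⟩ := key
  -- Real and imaginary parts each move by less than a third of the gap, which leaves the last
  -- third.
  refine ⟨η / 3, by positivity, fun u hu z hz => ?_⟩
  rw [mem_ball, dist_eq_norm] at hu
  have h1 := (norm_reVec_le (u - u₀)).trans_lt hu
  have h2 := (norm_imVec_le (u - u₀)).trans_lt hu
  rw [reVec_sub] at h1
  rw [imVec_sub] at h2
  have h3 := norm_sub_norm_le (imVec u) (imVec u₀)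
  have h4 := norm_sub_norm_le (reVec u₀ - z) (reVec u - z)
  rw [show reVec u₀ - z - (reVec u - z) = -(reVec u - reVec u₀) by abel, norm_neg] at h4
  linarith [h z hz]

theorem isOpen_coneDomain (B : Matrix (Fin d) (Fin d) ℝ) (hB : B.det ≠ 0)
    {L : Set (RSpace d)} (hL : L ⊆ lattice B) : IsOpen (coneDomain L) := by
  refine Metric.isOpen_iff.2 fun u₀ hu => ?_
  obtain ⟨η, hη, h⟩ := exists_gap_of_mem_coneDomain B hB hL hu
  exact ⟨η, hη, fun u hu z hz => by linarith [h u hu z hz]⟩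

theorem ofRealVec_mem_coneDomain {L : Set (RSpace d)} {x : RSpace d} :
    ofRealVec x ∈ coneDomain L ↔ x ∉ L := by
  simp only [coneDomain, mem_ofPred_eq, imVec_ofRealVec, reVec_ofRealVec, norm_zero, norm_pos_iff,
    sub_ne_zero]
  exact ⟨fun h hx => h x hx rfl, fun h z hz hxz => h (hxz ▸ hz)⟩

/-- The bilinear extension of the Euclidean inner product to complex vectors. -/
noncomputable def bilin (u v : CSpace d) : ℂ := ∑ i, u i * v i

theorem bilin_ofRealVec (x y : RSpace d) :
    bilin (ofRealVec x) (ofRealVec y) = (inner ℝ x y : ℝ) := by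
  simp [bilin, ofRealVec, PiLp.inner_apply, mul_comm]

theorem bilin_self_ofRealVec (x : RSpace d) :
    bilin (ofRealVec x) (ofRealVec x) = ((‖x‖ ^ 2 : ℝ) : ℂ) := by
  rw [bilin_ofRealVec, real_inner_self_eq_norm_sq]

/-- The source of the cones: the bilinear square lies in the right half-plane precisely when the
imaginary part is shorter than the real part. -/
theorem re_bilin_self (u : CSpace d) : (bilin u u).re = ‖reVec u‖ ^ 2 - ‖imVec u‖ ^ 2 := by
  simp only [EuclideanSpace.norm_sq_eq, ← Finset.sum_sub_distrib]
  simp [bilin, reVec, imVec, sq]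

theorem im_bilin_ofRealVec (v : CSpace d) (z : RSpace d) :
    (bilin v (ofRealVec z)).im = inner ℝ (imVec v) z := by
  simp [bilin, ofRealVec, imVec, PiLp.inner_apply, mul_comm]

theorem ofRealVec_sub (x y : RSpace d) : ofRealVec (x - y) = ofRealVec x - ofRealVec y := by
  ext i; simp [ofRealVec]

theorem differentiable_bilin {E : Type*} [NormedAddCommGroup E] [NormedSpace ℂ E]
    {f g : E → CSpace d} (hf : Differentiable ℂ f) (hg : Differentiable ℂ g) :
    Differentiable ℂ fun e => bilin (f e) (g e) := by
  unfold bilin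
  fun_prop

theorem continuous_ofRealVec : Continuous (ofRealVec : RSpace d → CSpace d) := by
  unfold ofRealVec
  fun_prop

/-! ### Series of holomorphic functions; uniqueness of the continuation -/

/-- A locally normally convergent series of holomorphic functions of several variables is
holomorphic. -/
theorem differentiableOn_tsum_of_locally_bounded {E ι : Type*} [NormedAddCommGroup E]
    [NormedSpace ℂ E] {f : ι → E → ℂ} {U : Set E} (hU : IsOpen U)
    (hf : ∀ i, DifferentiableOn ℂ (f i) U)
    (hb : ∀ x₀ ∈ U, ∃ V ∈ 𝓝 x₀, ∃ u : ι → ℝ, Summable u ∧ ∀ i, ∀ x ∈ V, ‖f i x‖ ≤ u i) :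
    DifferentiableOn ℂ (fun x => ∑' i, f i x) U := by
  intro x₀ hx₀
  obtain ⟨V, hV, u, hu, hfu⟩ := hb x₀ hx₀
  obtain ⟨r, hr, hrV⟩ := Metric.mem_nhds_iff.1 (inter_mem hV (hU.mem_nhds hx₀))
  let _ : NormedSpace ℝ E := NormedSpace.restrictScalars ℝ ℂ E
  have hsub : ∀ x ∈ ball x₀ (r / 2), ball x (r / 2) ⊆ ball x₀ r := fun x hx =>
    ball_subset_ball' (by linarith [mem_ball.1 hx])
  have hx₀' : x₀ ∈ ball x₀ (r / 2) := mem_ball_self (by positivity)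
  refine (HasFDerivAt.differentiableAt (f' := ∑' i, fderiv ℂ (f i) x₀) ?_).differentiableWithinAt
  -- Cauchy-type estimate: on a ball of radius r/2 the i-th function stays within 2 uᵢ of its value
  -- at the centre, which bounds its derivative.
  refine hasFDerivAt_tsum_of_isPreconnected (u := fun i => 2 * u i / (r / 2))
    (f' := fun i x => fderiv ℂ (f i) x) (s := ball x₀ (r / 2)) (x₀ := x₀)
    ((hu.mul_left 2).div_const _) isOpen_ball (convex_ball _ _).isPreconnected ?_ ?_ hx₀' ?_ hx₀'
  · intro i x hx
    have hxU : x ∈ U := (hrV (hsub x hx (mem_ball_self (by positivity)))).2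
    exact ((hf i).differentiableAt (hU.mem_nhds hxU)).hasFDerivAt
  · intro i x hx
    refine Complex.norm_fderiv_le_div_of_mapsTo_ball
      ((hf i).mono fun z hz => (hrV (hsub x hx hz)).2) ?_ (by positivity)
    intro z hz
    have h1 := hfu i z (hrV (hsub x hx hz)).1
    have h2 := hfu i x (hrV (hsub x hx (mem_ball_self (by positivity)))).1
    rw [mem_closedBall, dist_eq_norm]
    linarith [norm_sub_le (f i z) (f i x)]
  · exact Summable.of_norm_bounded hu fun i => hfu i x₀ (mem_of_mem_nhds hV)

/-- A meromorphic continuation that is entire is the meromorphic continuation. -/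
theorem meromorphicContinuation_eq {c : ℝ} {f g : ℂ → ℂ} (hg : Differentiable ℂ g)
    (h : ∀ s : ℂ, c < s.re → g s = f s) : meromorphicContinuation c f = g := by
  have hga : ∀ s, AnalyticAt ℂ g s := fun s => hg.analyticAt s
  have hex : ∃ g, IsMeromorphicContinuation c f g :=
    ⟨g, fun s _ => (hga s).meromorphicNFAt, h⟩
  rw [meromorphicContinuation, dif_pos hex]
  obtain ⟨hm, hc⟩ := hex.choose_spec
  set k := hex.choose
  have hmer : MeromorphicOn (k - g) univ := fun s hs =>
    (hm hs).meromorphicAt.sub (hga s).meromorphicAt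
  -- Infinite order at one point spreads over the connected plane, and k - g vanishes near c + 1.
  have htop : ∀ s, meromorphicOrderAt (k - g) s = ⊤ := by
    intro s
    by_contra hs
    refine hmer.meromorphicOrderAt_ne_top_of_isPreconnected (x := s) (y := ((c + 1 : ℝ) : ℂ))
      isPreconnected_univ (mem_univ _) (mem_univ _) hs ?_
    rw [meromorphicOrderAt_eq_top_iff]
    have : {z : ℂ | c < z.re} ∈ 𝓝 ((c + 1 : ℝ) : ℂ) :=
      (isOpen_lt continuous_const Complex.continuous_re).mem_nhds (by simp)
    filter_upwards [mem_nhdsWithin_of_mem_nhds this] with z hz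
    simp [hc z hz, h z hz]
  ext s
  -- So far the functions agree only on punctured neighbourhoods; the normal form determines the
  -- value at the centre.
  have h1 : k =ᶠ[𝓝[≠] s] g := by
    filter_upwards [meromorphicOrderAt_eq_top_iff.1 (htop s)] with z hz
    exact sub_eq_zero.1 hz
  exact (((hm (mem_univ s)).eventuallyEq_nhdsNE_iff_eventuallyEq_nhds
    (hga s).meromorphicNFAt).1 h1).eq_of_nhds

/-! ### Upper incomplete gamma function -/

/-- The upper incomplete gamma function in the normalisation
`∫ t ^ (s - 1) * exp (- π w t)` over `t > 1`. -/
noncomputable def upperGamma (s w : ℂ) : ℂ :=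
  ∫ t in Ioi (1 : ℝ), Complex.exp ((s - 1) * Real.log t - Real.pi * w * t)

theorem norm_upperGamma_integrand (s w : ℂ) (t : ℝ) :
    ‖Complex.exp ((s - 1) * Real.log t - Real.pi * w * t)‖ =
      Real.exp ((s.re - 1) * Real.log t - Real.pi * w.re * t) := by
  rw [Complex.norm_exp]
  simp

theorem integrableOn_exp_log_sub_mul (σ : ℝ) {b : ℝ} (hb : 0 < b) :
    IntegrableOn (fun t : ℝ => Real.exp (σ * Real.log t - b * t)) (Ioi 1) := by
  -- Since log t ≥ 0 for t > 1, σ may be replaced by |σ|, which makes the majorant integrable down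
  -- to 0.
  have h := (integrableOn_rpow_mul_exp_neg_mul_rpow (s := |σ|) (p := 1) (b := b)
    (by linarith [abs_nonneg σ]) one_pos hb).mono_set (Ioi_subset_Ioi (zero_le_one' ℝ))
  refine Integrable.mono' h (by fun_prop) ?_
  filter_upwards [ae_restrict_mem measurableSet_Ioi] with t ht
  have ht0 : 0 < t := zero_lt_one.trans ht
  rw [Real.norm_of_nonneg (Real.exp_pos _).le, Real.rpow_def_of_pos ht0, ← Real.exp_add,
    Real.rpow_one, Real.exp_le_exp]
  have := mul_le_mul_of_nonneg_right (le_abs_self σ) (Real.log_nonneg (le_of_lt ht))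
  linarith

theorem integrableOn_upperGamma (s : ℂ) {w : ℂ} (hw : 0 < w.re) :
    IntegrableOn (fun t : ℝ => Complex.exp ((s - 1) * Real.log t - Real.pi * w * t)) (Ioi 1) := by
  refine Integrable.mono' (integrableOn_exp_log_sub_mul (s.re - 1)
    (mul_pos Real.pi_pos hw)) (by fun_prop) (ae_of_all _ fun t => ?_)
  rw [norm_upperGamma_integrand]

/-- For t ≥ 1 one has (Re w - c)(t - 1) ≥ 0, so the factor exp(-π(Re w - c)) can be pulled out of
the integral. The constant is uniform in the half-planes for s and w, as the lattice sums require.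
-/
theorem exists_norm_upperGamma_le (σ : ℝ) {c : ℝ} (hc : 0 < c) :
    ∃ C, 0 ≤ C ∧ ∀ s w : ℂ, s.re ≤ σ → c ≤ w.re →
      ‖upperGamma s w‖ ≤ C * Real.exp (-(Real.pi * w.re)) := by
  have hπ := Real.pi_pos
  refine ⟨(∫ t in Ioi (1 : ℝ), Real.exp ((σ - 1) * Real.log t - Real.pi * c * t)) *
    Real.exp (Real.pi * c), mul_nonneg (integral_nonneg fun t => (Real.exp_pos _).le)
    (Real.exp_pos _).le, fun s w hs hw => ?_⟩
  have hint := integrableOn_exp_log_sub_mul (σ - 1) (mul_pos hπ hc)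
  rw [mul_assoc, ← Real.exp_add, ← integral_mul_const, upperGamma]
  refine norm_integral_le_of_norm_le (hint.mul_const _) ?_
  filter_upwards [ae_restrict_mem measurableSet_Ioi] with t ht
  rw [norm_upperGamma_integrand, ← Real.exp_add, Real.exp_le_exp]
  have h1 := mul_le_mul_of_nonneg_right hs (Real.log_nonneg (le_of_lt ht))
  have h2 : 0 ≤ Real.pi * (w.re - c) * (t - 1) :=
    mul_nonneg (mul_nonneg hπ.le (sub_nonneg.2 hw)) (sub_nonneg.2 (le_of_lt ht))
  nlinarith

/-- The derivative of the exponent of the integrand of `upperGamma`. -/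
noncomputable def exponentDeriv (t : ℝ) : ℂ × ℂ →L[ℂ] ℂ :=
  (Real.log t : ℂ) • ContinuousLinearMap.fst ℂ ℂ ℂ -
    (Real.pi * t : ℂ) • ContinuousLinearMap.snd ℂ ℂ ℂ

theorem norm_exponentDeriv_le {t : ℝ} (ht : 1 < t) : ‖exponentDeriv t‖ ≤ t * (1 + Real.pi) := by
  have ht0 : 0 < t := zero_lt_one.trans ht
  have hlog := Real.log_nonneg ht.le
  have hlog' : Real.log t ≤ t := (Real.log_le_sub_one_of_pos ht0).trans (by linarith)
  refine (norm_sub_le _ _).trans ?_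
  rw [norm_smul, norm_smul]
  have e1 : ‖(Real.log t : ℂ)‖ = Real.log t := by
    rw [Complex.norm_real, Real.norm_of_nonneg hlog]
  have e2 : ‖(Real.pi * t : ℂ)‖ = Real.pi * t := by
    rw [← Complex.ofReal_mul, Complex.norm_real,
      Real.norm_of_nonneg (mul_pos Real.pi_pos ht0).le]
  rw [e1, e2]
  have a1 := mul_le_mul_of_nonneg_left (ContinuousLinearMap.norm_fst_le ℂ ℂ ℂ) hlog
  have a2 := mul_le_mul_of_nonneg_left (ContinuousLinearMap.norm_snd_le ℂ ℂ ℂ)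
    (mul_pos Real.pi_pos ht0).le
  linarith

theorem hasFDerivAt_upperGamma_integrand (t : ℝ) (p : ℂ × ℂ) :
    HasFDerivAt (fun p : ℂ × ℂ => Complex.exp ((p.1 - 1) * Real.log t - Real.pi * p.2 * t))
      (Complex.exp ((p.1 - 1) * Real.log t - Real.pi * p.2 * t) • exponentDeriv t) p := by
  have a := (((ContinuousLinearMap.fst ℂ ℂ ℂ).hasFDerivAt (x := p)).sub_const 1).mul_const
    (Real.log t : ℂ)
  have b := (((ContinuousLinearMap.snd ℂ ℂ ℂ).hasFDerivAt (x := p)).const_mul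
    (Real.pi : ℂ)).mul_const (t : ℂ)
  have h := (a.sub b).cexp
  rw [smul_smul, mul_comm (t : ℂ)] at h
  exact h

theorem measurable_exponentDeriv : Measurable exponentDeriv := by
  unfold exponentDeriv
  refine Measurable.sub ?_ ?_
  · exact Measurable.smul_const (by fun_prop) _
  · exact Measurable.smul_const (by fun_prop) _

theorem differentiableOn_upperGamma :
    DifferentiableOn ℂ (fun p : ℂ × ℂ => upperGamma p.1 p.2) {p | 0 < p.2.re} := by
  have hπ := Real.pi_pos
  rintro ⟨s₀, w₀⟩ (hw₀ : 0 < w₀.re)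
  refine DifferentiableAt.differentiableWithinAt ?_
  obtain ⟨c, hc0, hc⟩ := exists_between hw₀
  set V : Set (ℂ × ℂ) := {p | p.1.re < s₀.re + 1 ∧ c < p.2.re}
  have hVo : IsOpen V :=
    (isOpen_lt (Complex.continuous_re.comp continuous_fst) continuous_const).inter
      (isOpen_lt continuous_const (Complex.continuous_re.comp continuous_snd))
  have hV : V ∈ 𝓝 (s₀, w₀) := hVo.mem_nhds ⟨by simp, hc⟩
  -- Differentiating the exponent costs a factor at most t(1 + π); the t is absorbed by raising the
  -- power of t by one.
  have hbound : ∀ᵐ t ∂(volume.restrict (Ioi (1 : ℝ))), ∀ p ∈ V,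
      ‖Complex.exp ((p.1 - 1) * Real.log t - Real.pi * p.2 * t) • exponentDeriv t‖ ≤
        Real.exp ((s₀.re + 1) * Real.log t - Real.pi * c * t) * (1 + Real.pi) := by
    filter_upwards [ae_restrict_mem measurableSet_Ioi] with t ht p hp
    have ht0 : 0 < t := zero_lt_one.trans ht
    have h2 : Real.exp ((s₀.re + 1) * Real.log t - Real.pi * c * t) =
        Real.exp (s₀.re * Real.log t - Real.pi * c * t) * t := by
      rw [show (s₀.re + 1) * Real.log t - Real.pi * c * t =
        s₀.re * Real.log t - Real.pi * c * t + Real.log t by ring, Real.exp_add, Real.exp_log ht0]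
    rw [norm_smul, norm_upperGamma_integrand, h2, mul_assoc (Real.exp _)]
    refine mul_le_mul (Real.exp_le_exp.2 ?_) (norm_exponentDeriv_le ht) (norm_nonneg _)
      (Real.exp_pos _).le
    have b0 : p.1.re - 1 ≤ s₀.re := by linarith [hp.1]
    have b1 := mul_le_mul_of_nonneg_right b0 (Real.log_nonneg (le_of_lt ht))
    have b2 := mul_le_mul_of_nonneg_right (mul_le_mul_of_nonneg_left hp.2.le hπ.le) ht0.le
    linarith
  have hm : Measurable fun t : ℝ =>
      Complex.exp ((s₀ - 1) * Real.log t - Real.pi * w₀ * t) := by fun_prop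
  have hmeas : AEStronglyMeasurable (fun t : ℝ =>
      Complex.exp ((s₀ - 1) * Real.log t - Real.pi * w₀ * t) • exponentDeriv t)
      (volume.restrict (Ioi (1 : ℝ))) :=
    (hm.smul measurable_exponentDeriv).aestronglyMeasurable
  have hint := (integrableOn_exp_log_sub_mul (s₀.re + 1) (mul_pos hπ hc0)).mul_const
    (1 + Real.pi)
  have hmeas' : ∀ᶠ p : ℂ × ℂ in 𝓝 (s₀, w₀), AEStronglyMeasurable (fun t : ℝ =>
      Complex.exp ((p.1 - 1) * Real.log t - Real.pi * p.2 * t))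
      (volume.restrict (Ioi (1 : ℝ))) :=
    Eventually.of_forall fun p => Measurable.aestronglyMeasurable (by fun_prop)
  have key := hasFDerivAt_integral_of_dominated_of_fderiv_le (𝕜 := ℂ) (x₀ := (s₀, w₀))
    (F := fun (p : ℂ × ℂ) (t : ℝ) => Complex.exp ((p.1 - 1) * Real.log t - Real.pi * p.2 * t))
    (F' := fun p t => Complex.exp ((p.1 - 1) * Real.log t - Real.pi * p.2 * t) • exponentDeriv t)
    hV hmeas' (integrableOn_upperGamma s₀ hw₀) hmeas hbound hint
    (ae_of_all _ fun t p _ => hasFDerivAt_upperGamma_integrand t p)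
  exact key.differentiableAt

theorem exp_log_eq_cpow {t : ℝ} (ht : 0 < t) (s w : ℂ) :
    Complex.exp ((s - 1) * Real.log t - Real.pi * w * t) =
      (t : ℂ) ^ (s - 1) * Complex.exp (-(Real.pi * w * t)) := by
  rw [Complex.cpow_def_of_ne_zero (by exact_mod_cast ht.ne'), ← Complex.exp_add,
    Complex.ofReal_log ht.le]
  ring_nf

theorem integrableOn_exp_log_Ioc {s : ℂ} (hs : 0 < s.re) (w : ℂ) :
    IntegrableOn (fun t : ℝ => Complex.exp ((s - 1) * Real.log t - Real.pi * w * t))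
      (Ioc 0 1) := by
  have h := (intervalIntegral.intervalIntegrable_cpow' (a := 0) (b := 1) (r := s - 1)
    (by simpa using hs))
  rw [intervalIntegrable_iff_integrableOn_Ioc_of_le zero_le_one] at h
  refine Integrable.congr (h.mul_continuousOn_of_subset
    (g' := fun t : ℝ => Complex.exp (-(Real.pi * w * t))) (by fun_prop) measurableSet_Ioc
    (isCompact_Icc (a := (0 : ℝ)) (b := 1)) Ioc_subset_Icc_self) ?_
  filter_upwards [ae_restrict_mem measurableSet_Ioc] with t ht
  rw [exp_log_eq_cpow ht.1]

/-- The Mellin transform of an exponential, split at `1`. -/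
theorem upperGamma_add_integral_Ioc {s : ℂ} (hs : 0 < s.re) {r : ℝ} (hr : 0 < r) :
    upperGamma s r + ∫ t in Ioc (0 : ℝ) 1,
      Complex.exp ((s - 1) * Real.log t - Real.pi * (r : ℂ) * t) =
      Complex.Gamma s * ((Real.pi * r : ℝ) : ℂ) ^ (-s) := by
  have h1 := integrableOn_upperGamma s (w := (r : ℂ)) (by simpa)
  have h2 := integrableOn_exp_log_Ioc hs (r : ℂ)
  rw [upperGamma, add_comm, ← setIntegral_union (Ioc_disjoint_Ioi le_rfl) measurableSet_Ioi h2 h1,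
    Ioc_union_Ioi_eq_Ioi zero_le_one]
  have hp : 0 < Real.pi * r := mul_pos Real.pi_pos hr
  have h := Complex.integral_cpow_mul_exp_neg_mul_Ioi hs hp
  rw [Complex.cpow_neg, mul_comm (Complex.Gamma s), ← Complex.inv_cpow, ← one_div, ← h]
  · refine setIntegral_congr_fun measurableSet_Ioi fun t ht => ?_
    rw [exp_log_eq_cpow ht]
    push_cast
    rfl
  · rw [Complex.arg_ofReal_of_nonneg hp.le]
    exact Real.pi_pos.ne

/-! ### Lower incomplete gamma function and the complete gamma integral -/

/-- The power series of the lower incomplete gamma function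
`∫ t ^ (s - 1) * exp (- π w t)` over `0 < t < 1`, with the exponents restricted to `T`. -/
noncomputable def lowerGamma (T : Set ℕ) (s w : ℂ) : ℂ :=
  ∑' n : T, (-(Real.pi * w)) ^ (n : ℕ) / ((n : ℕ).factorial * (s + (n : ℕ)))

/-- As |s₀ + n| → ∞, its minimum over T is attained and positive; half of it works on a ball. This
bounds all denominators of `lowerGamma` at once. -/
theorem exists_le_norm_add_natCast (T : Set ℕ) {s₀ : ℂ} (hs : ∀ n ∈ T, s₀ + (n : ℂ) ≠ 0) :
    ∃ δ > 0, ∀ s ∈ ball s₀ δ, ∀ n ∈ T, δ ≤ ‖s + (n : ℂ)‖ := by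
  have key : ∃ δ > 0, ∀ n ∈ T, δ ≤ ‖s₀ + (n : ℂ)‖ := by
    rcases T.eq_empty_or_nonempty with rfl | hne
    · exact ⟨1, one_pos, by simp⟩
    have : Nonempty T := hne.to_subtype
    have ht : Tendsto (fun n : ℕ => ‖s₀ + (n : ℂ)‖) cofinite atTop := by
      rw [Nat.cofinite_eq_atTop]
      refine tendsto_atTop_mono (f := fun n : ℕ => (n : ℝ) - ‖s₀‖) (fun n => ?_)
        (tendsto_atTop_add_const_right _ _ tendsto_natCast_atTop_atTop)
      have := norm_sub_norm_le (n : ℂ) (-s₀)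
      rw [norm_neg, sub_neg_eq_add, add_comm, Complex.norm_natCast] at this
      exact this
    obtain ⟨n, hn⟩ :=
      (ht.comp (Subtype.val_injective (p := (· ∈ T))).tendsto_cofinite).exists_forall_le
    exact ⟨_, norm_pos_iff.2 (hs n n.2), fun m hm => hn ⟨m, hm⟩⟩
  obtain ⟨δ, hδ, h⟩ := key
  refine ⟨δ / 2, by positivity, fun s hs n hn => ?_⟩
  rw [mem_ball, dist_comm, dist_eq_norm] at hs
  have := norm_sub_norm_le (s₀ + (n : ℂ)) (s + n)
  rw [add_sub_add_right_eq_sub] at this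
  linarith [h n hn]

theorem isOpen_forall_add_natCast_ne (T : Set ℕ) : IsOpen {s : ℂ | ∀ n ∈ T, s + (n : ℂ) ≠ 0} := by
  refine Metric.isOpen_iff.2 fun s₀ hs => ?_
  obtain ⟨δ, hδ, h⟩ := exists_le_norm_add_natCast T hs
  exact ⟨δ, hδ, fun s hs n hn => norm_pos_iff.1 (hδ.trans_le (h s hs n hn))⟩

theorem norm_lowerGamma_term_le {s w : ℂ} {n : ℕ} {δ R : ℝ} (hδ : 0 < δ)
    (h : δ ≤ ‖s + (n : ℂ)‖) (hR : ‖w‖ ≤ R) :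
    ‖(-(Real.pi * w)) ^ n / (n.factorial * (s + n))‖ ≤
      (Real.pi * R) ^ n / n.factorial * δ⁻¹ := by
  have hπ := Real.pi_pos
  rw [norm_div, norm_pow, norm_neg, norm_mul, norm_mul, Complex.norm_real,
    Real.norm_of_nonneg hπ.le, Complex.norm_natCast, div_mul_eq_div_div, div_eq_mul_inv _ ‖s + n‖]
  have := (norm_nonneg w).trans hR
  gcongr

theorem differentiableOn_lowerGamma (T : Set ℕ) :
    DifferentiableOn ℂ (fun p : ℂ × ℂ => lowerGamma T p.1 p.2)
      {p | ∀ n ∈ T, p.1 + (n : ℂ) ≠ 0} := by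
  refine differentiableOn_tsum_of_locally_bounded
    ((isOpen_forall_add_natCast_ne T).preimage continuous_fst) (fun n => ?_) ?_
  · intro p hp
    have : ((n : ℕ).factorial : ℂ) * (p.1 + (n : ℕ)) ≠ 0 :=
      mul_ne_zero (by exact_mod_cast Nat.factorial_ne_zero _) (hp n n.2)
    exact DifferentiableAt.differentiableWithinAt (by fun_prop (disch := assumption))
  · rintro ⟨s₀, w₀⟩ hp
    obtain ⟨δ, hδ, h⟩ := exists_le_norm_add_natCast T hp
    refine ⟨ball s₀ δ ×ˢ ball w₀ 1, prod_mem_nhds (ball_mem_nhds _ hδ) (ball_mem_nhds _ one_pos),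
      fun n => (Real.pi * (‖w₀‖ + 1)) ^ (n : ℕ) / (n : ℕ).factorial * δ⁻¹,
      ((Real.summable_pow_div_factorial _).subtype T).mul_right _, fun n x hx => ?_⟩
    refine norm_lowerGamma_term_le hδ (h _ hx.1 n n.2) ?_
    have h1 := hx.2
    rw [mem_ball, dist_eq_norm] at h1
    linarith [norm_sub_norm_le x.2 w₀]

theorem differentiable_upperGamma_left {w : ℂ} (hw : 0 < w.re) :
    Differentiable ℂ fun s => upperGamma s w := by
  rw [← differentiableOn_univ]
  exact differentiableOn_upperGamma.comp (f := fun s : ℂ => (s, w)) (t := {p | 0 < p.2.re})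
    (by fun_prop) (fun s _ => hw)

theorem differentiableOn_lowerGamma_left (T : Set ℕ) (w : ℂ) :
    DifferentiableOn ℂ (fun s => lowerGamma T s w) {s | ∀ n ∈ T, s + (n : ℂ) ≠ 0} :=
  (differentiableOn_lowerGamma T).comp (f := fun s : ℂ => (s, w))
    (by fun_prop) (fun s h => h)

theorem summable_lowerGamma (T : Set ℕ) {s : ℂ} (hs : ∀ n ∈ T, s + (n : ℂ) ≠ 0) (w : ℂ) :
    Summable fun n : T => (-(Real.pi * w)) ^ (n : ℕ) / ((n : ℕ).factorial * (s + (n : ℕ))) := by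
  obtain ⟨δ, hδ, h⟩ := exists_le_norm_add_natCast T hs
  exact Summable.of_norm_bounded (((Real.summable_pow_div_factorial _).subtype T).mul_right _)
    fun n => norm_lowerGamma_term_le hδ (h s (mem_ball_self hδ) n n.2) le_rfl

/-- Isolates the only term with a pole at s = -k. -/
theorem lowerGamma_eq_skip_add (k : ℕ) {s : ℂ} (hs : ∀ n : ℕ, s + (n : ℂ) ≠ 0) (w : ℂ) :
    lowerGamma univ s w =
      lowerGamma {k}ᶜ s w + (-(Real.pi * w)) ^ k / (k.factorial * (s + k)) := by
  have hsum : Summable fun n : ℕ => (-(Real.pi * w)) ^ n / (n.factorial * (s + n)) :=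
    (Equiv.Set.univ ℕ).summable_iff.1 (summable_lowerGamma univ (fun n _ => hs n) w)
  have h := hsum.tsum_subtype_add_tsum_subtype_compl {k}
  rw [lowerGamma, tsum_univ fun n : ℕ => (-(Real.pi * w)) ^ n / (n.factorial * (s + n)), ← h,
    tsum_singleton k fun n : ℕ => (-(Real.pi * w)) ^ n / (n.factorial * (s + n)), add_comm]
  rfl

/-- Expand the exponential and integrate termwise; the power integrals are bounded by 1 / Re s
uniformly in n, so the exchange is dominated by an exponential series. -/
theorem integral_Ioc_eq_lowerGamma {s : ℂ} (hs : 0 < s.re) (w : ℂ) :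
    ∫ t in Ioc (0 : ℝ) 1, Complex.exp ((s - 1) * Real.log t - Real.pi * w * t) =
      lowerGamma univ s w := by
  have hre : ∀ n : ℕ, -1 < (s - 1 + n).re := fun n => by
    have : (0 : ℝ) ≤ n := n.cast_nonneg
    simp only [Complex.add_re, Complex.sub_re, Complex.one_re, Complex.natCast_re]
    linarith
  have hint : ∀ n : ℕ, IntegrableOn (fun t : ℝ => (t : ℂ) ^ (s - 1 + n)) (Ioc 0 1) := fun n => by
    rw [← intervalIntegrable_iff_integrableOn_Ioc_of_le zero_le_one]
    exact intervalIntegral.intervalIntegrable_cpow' (hre n)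
  have hval : ∀ n : ℕ, ∫ t in Ioc (0 : ℝ) 1, (t : ℂ) ^ (s - 1 + n) = 1 / (s + n) := fun n => by
    rw [← intervalIntegral.integral_of_le zero_le_one, integral_cpow (Or.inl (hre n))]
    have : s - 1 + n + 1 = s + n := by ring
    have h0 : s + n ≠ 0 := fun h => by
      have := hre n
      rw [show s - 1 + (n : ℂ) = s + n - 1 by ring, h] at this
      simp at this
    rw [this, Complex.ofReal_one, Complex.one_cpow, Complex.ofReal_zero, Complex.zero_cpow h0,
      sub_zero]
  have hnorm : ∀ n : ℕ, ∫ t in Ioc (0 : ℝ) 1, ‖(t : ℂ) ^ (s - 1 + n)‖ ≤ 1 / s.re := fun n => by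
    have h1 : ∀ t ∈ Ioc (0 : ℝ) 1, ‖(t : ℂ) ^ (s - 1 + n)‖ ≤ t ^ (s.re - 1) := fun t ht => by
      rw [Complex.norm_cpow_eq_rpow_re_of_pos ht.1]
      refine Real.rpow_le_rpow_of_exponent_ge ht.1 ht.2 ?_
      simp
    have h2 : IntegrableOn (fun t : ℝ => t ^ (s.re - 1)) (Ioc 0 1) := by
      rw [← intervalIntegrable_iff_integrableOn_Ioc_of_le zero_le_one]
      exact intervalIntegral.intervalIntegrable_rpow' (by linarith)
    refine (setIntegral_mono_on (hint n).norm h2 measurableSet_Ioc h1).trans_eq ?_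
    rw [← intervalIntegral.integral_of_le zero_le_one, integral_rpow (Or.inl (by linarith))]
    simp [Real.zero_rpow hs.ne']
  have hs' := hasSum_integral_of_summable_integral_norm
    (F := fun (n : ℕ) (t : ℝ) => (-(Real.pi * w)) ^ n / n.factorial * (t : ℂ) ^ (s - 1 + n))
    (μ := volume.restrict (Ioc 0 1)) (fun n => (hint n).const_mul _) ?_
  · have hF : ∀ t ∈ Ioc (0 : ℝ) 1,
        ∑' n : ℕ, (-(Real.pi * w)) ^ n / n.factorial * (t : ℂ) ^ (s - 1 + n) =
        Complex.exp ((s - 1) * Real.log t - Real.pi * w * t) := fun t ht => by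
      have ht0 : (t : ℂ) ≠ 0 := by exact_mod_cast ht.1.ne'
      rw [exp_log_eq_cpow ht.1, Complex.exp_eq_exp_ℂ, NormedSpace.exp_eq_tsum_div, ← tsum_mul_left]
      refine tsum_congr fun n => ?_
      rw [Complex.cpow_add _ _ ht0, Complex.cpow_natCast, ← neg_mul, mul_pow]
      ring
    rw [← setIntegral_congr_fun measurableSet_Ioc hF, ← hs'.tsum_eq, lowerGamma,
      tsum_univ fun n : ℕ => (-(Real.pi * w)) ^ n / (n.factorial * (s + n))]
    refine tsum_congr fun n => ?_
    rw [integral_const_mul, hval, div_mul_div_comm, mul_one]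
  · refine Summable.of_nonneg_of_le (fun n => integral_nonneg fun t => norm_nonneg _) (fun n => ?_)
      ((Real.summable_pow_div_factorial (Real.pi * ‖w‖)).mul_right (1 / s.re))
    simp_rw [norm_mul]
    rw [integral_const_mul]
    refine mul_le_mul (le_of_eq ?_) (hnorm n) (integral_nonneg fun t => norm_nonneg _)
      (by positivity)
    simp [abs_of_pos Real.pi_pos]

/-- The sum of the upper and the lower incomplete gamma function. -/
theorem upperGamma_add_lowerGamma {s : ℂ} (hs : ∀ n : ℕ, s + (n : ℂ) ≠ 0) {r : ℝ} (hr : 0 < r) :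
    upperGamma s r + lowerGamma univ s r =
      Complex.Gamma s * ((Real.pi * r : ℝ) : ℂ) ^ (-s) := by
  set U : Set ℂ := {s | ∀ n ∈ (univ : Set ℕ), s + (n : ℂ) ≠ 0} with hU
  have hUo : IsOpen U := isOpen_forall_add_natCast_ne univ
  -- The plane minus countably many points is connected, so the identity theorem carries the formula
  -- over from Re s > 0.
  have hUc : IsPreconnected U := by
    have : U = (range fun n : ℕ => -(n : ℂ))ᶜ := by
      ext s
      simp [hU, add_eq_zero_iff_eq_neg, eq_comm]
    rw [this]
    exact ((countable_range _).isPathConnected_compl_of_one_lt_rank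
      (by simp)).isConnected.isPreconnected
  have hf : AnalyticOnNhd ℂ (fun s => upperGamma s r + lowerGamma univ s r) U := by
    refine DifferentiableOn.analyticOnNhd (fun s hs => ?_) hUo
    refine DifferentiableWithinAt.add ?_ ?_
    · exact (differentiable_upperGamma_left (by simpa using hr) s).differentiableWithinAt
    · exact differentiableOn_lowerGamma_left univ r s hs
  have hp : ((Real.pi * r : ℝ) : ℂ) ≠ 0 := by exact_mod_cast (mul_pos Real.pi_pos hr).ne'
  have hg : AnalyticOnNhd ℂ (fun s => Complex.Gamma s * ((Real.pi * r : ℝ) : ℂ) ^ (-s)) U := by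
    refine DifferentiableOn.analyticOnNhd (fun s hs => DifferentiableAt.differentiableWithinAt ?_)
      hUo
    refine (Complex.differentiableAt_Gamma s fun m h => hs m (mem_univ _) (by simp [h])).mul ?_
    exact DifferentiableAt.const_cpow (by fun_prop) (Or.inl hp)
  have h1 : (1 : ℂ) ∈ U := fun n _ => by
    have : (1 : ℂ) + n = ((n + 1 : ℕ) : ℂ) := by push_cast; ring
    rw [this]
    exact_mod_cast n.succ_ne_zero
  refine hf.eqOn_of_preconnected_of_eventuallyEq hg hUc h1 ?_ (fun n _ => hs n)
  have : {s : ℂ | 0 < s.re} ∈ 𝓝 (1 : ℂ) :=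
    (isOpen_lt continuous_const Complex.continuous_re).mem_nhds (by simp)
  filter_upwards [this] with s hs
  rw [← integral_Ioc_eq_lowerGamma hs, upperGamma_add_integral_Ioc hs hr]

/-! ### Poles of the gamma function and the logarithmic case -/

/-- The simple poles of the gamma function. -/
theorem exists_Gamma_eq_div (k : ℕ) : ∃ ρ : ℂ → ℂ, DifferentiableAt ℂ ρ (-k) ∧
    ρ (-k) = (-1) ^ k / k.factorial ∧
    ∀ s : ℂ, (∀ n : ℕ, s + (n : ℂ) ≠ 0) → Complex.Gamma s = ρ s / (s + k) := by
  induction k with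
  | zero =>
    refine ⟨fun s => Complex.Gamma (s + 1), ?_, by simp, fun s hs => ?_⟩
    · have : DifferentiableAt ℂ Complex.Gamma ((-((0 : ℕ) : ℂ)) + 1) := by
        refine Complex.differentiableAt_Gamma _ fun m h => ?_
        have : ((m + 1 : ℕ) : ℂ) = 0 := by
          push_cast at h ⊢
          linear_combination h
        exact m.succ_ne_zero (by exact_mod_cast this)
      exact this.comp (-((0 : ℕ) : ℂ)) (f := fun s : ℂ => s + 1) (by fun_prop)
    · have h0 : s ≠ 0 := by simpa using hs 0
      simp only [Complex.Gamma_add_one s h0]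
      simp [h0]
  | succ k ih =>
    obtain ⟨ρ, h1, h2, h3⟩ := ih
    have hk : (-((k + 1 : ℕ) : ℂ)) + 1 = -k := by push_cast; ring
    have hk0 : (-((k + 1 : ℕ) : ℂ)) ≠ 0 := neg_ne_zero.2 (by exact_mod_cast k.succ_ne_zero)
    -- This is Γ(s) = Γ(s + 1) / s; at s = -(k+1) the factor 1/s turns (-1)^k / k! into the next
    -- value.
    refine ⟨fun s => ρ (s + 1) / s, ?_, ?_, fun s hs => ?_⟩
    · rw [← hk] at h1
      exact (h1.comp (-((k + 1 : ℕ) : ℂ)) (f := fun s : ℂ => s + 1) (by fun_prop)).div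
        differentiableAt_id hk0
    · simp only [hk, h2, Nat.factorial_succ]
      have : (k.factorial : ℂ) ≠ 0 := by exact_mod_cast k.factorial_ne_zero
      have : (k + 1 : ℂ) ≠ 0 := by exact_mod_cast k.succ_ne_zero
      push_cast
      field_simp
      ring
    · have h0 : s ≠ 0 := by simpa using hs 0
      have h4 := h3 (s + 1) fun n => by
        have := hs (n + 1)
        push_cast at this
        rwa [add_assoc, add_comm (1 : ℂ)]
      rw [Complex.Gamma_add_one s h0] at h4
      have hsk : s + 1 + (k : ℂ) ≠ 0 := by
        have := hs (k + 1)
        push_cast at this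
        rwa [add_assoc, add_comm (1 : ℂ)]
      rw [eq_div_iff hsk] at h4
      have hsk' : s + ((k + 1 : ℕ) : ℂ) ≠ 0 := hs (k + 1)
      show _ = ρ (s + 1) / s / _
      rw [← h4]
      field_simp
      push_cast
      ring

/-- The upper incomplete gamma function at its exceptional first arguments: a logarithmic term
and an entire function. -/
theorem exists_upperGamma_neg_natCast (k : ℕ) : ∃ c : ℂ, ∀ r : ℝ, 0 < r →
    upperGamma (-k) r + lowerGamma {k}ᶜ (-k) r =
      ((Real.pi * r : ℝ) : ℂ) ^ k *
        (c - (-1) ^ k / k.factorial * (Real.log (Real.pi * r) : ℂ)) := by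
  obtain ⟨ρ, hρ, hρk, hΓ⟩ := exists_Gamma_eq_div k
  -- Near s = -k, the complete integral minus the singular series term is the difference quotient of
  -- ρ(s) (πr)^(-s) at -k. Its limit is a derivative: ρ' gives the constant and the power gives the
  -- logarithm.
  refine ⟨deriv ρ (-k), fun r hr => ?_⟩
  have hp : 0 < Real.pi * r := mul_pos Real.pi_pos hr
  set q : ℂ := ((Real.pi * r : ℝ) : ℂ) with hq
  have hq0 : q ≠ 0 := Complex.ofReal_ne_zero.2 hp.ne'
  have hlogq : Complex.log q = (Real.log (Real.pi * r) : ℂ) := (Complex.ofReal_log hp.le).symm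
  set h : ℂ → ℂ := fun s => ρ s * q ^ (-s) with hh
  have hqk : q ^ (-(-(k : ℂ))) = q ^ k := by rw [neg_neg, Complex.cpow_natCast]
  have hder : HasDerivAt h (deriv ρ (-k) * q ^ k + (-1) ^ k / k.factorial *
      (q ^ k * Complex.log q * -1)) (-k) := by
    have h1 := hρ.hasDerivAt.mul (((hasDerivAt_id (-(k : ℂ))).neg).const_cpow (c := q) (Or.inl hq0))
    simp only [id, Pi.neg_apply, hqk, hρk] at h1
    exact h1
  have hnhds : ∀ᶠ s : ℂ in 𝓝[≠] (-(k : ℂ)), ∀ n : ℕ, s + (n : ℂ) ≠ 0 := by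
    have hmem : -(k : ℂ) ∈ {s : ℂ | ∀ n ∈ ({k}ᶜ : Set ℕ), s + (n : ℂ) ≠ 0} := fun n hn h0 => by
      rw [neg_add_eq_zero] at h0
      exact hn (by exact_mod_cast h0.symm)
    filter_upwards [mem_nhdsWithin_of_mem_nhds
      ((isOpen_forall_add_natCast_ne {k}ᶜ).mem_nhds hmem), self_mem_nhdsWithin] with s hs hsk n
    by_cases hn : n = k
    · subst hn
      intro h0
      exact hsk (eq_neg_of_add_eq_zero_left h0)
    · exact hs n hn
  have hlim1 : Tendsto (slope h (-k)) (𝓝[≠] (-(k : ℂ))) (𝓝 _) := hasDerivAt_iff_tendsto_slope.1 hder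
  have hlim2 : Tendsto (fun s => upperGamma s r + lowerGamma {k}ᶜ s r) (𝓝[≠] (-(k : ℂ)))
      (𝓝 (upperGamma (-k) r + lowerGamma {k}ᶜ (-k) r)) := by
    refine Tendsto.mono_left ?_ nhdsWithin_le_nhds
    refine Tendsto.add ?_ ?_
    · exact (differentiable_upperGamma_left (by simpa using hr)).continuous.tendsto _
    · refine ((differentiableOn_lowerGamma_left {k}ᶜ r).continuousOn.continuousAt
        ((isOpen_forall_add_natCast_ne {k}ᶜ).mem_nhds fun n hn h0 => ?_)).tendsto
      rw [neg_add_eq_zero] at h0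
      exact hn (by exact_mod_cast h0.symm)
  have heq : (fun s => upperGamma s r + lowerGamma {k}ᶜ s r) =ᶠ[𝓝[≠] (-(k : ℂ))]
      slope h (-k) := by
    filter_upwards [hnhds] with s hs
    have h1 := upperGamma_add_lowerGamma hs hr
    rw [lowerGamma_eq_skip_add k hs, ← hq, hΓ s hs] at h1
    have hsk := hs k
    rw [slope_def_field, hh]
    simp only [hqk, hρk, sub_neg_eq_add]
    have hneg : (-(Real.pi * (r : ℂ))) ^ k = (-1) ^ k * q ^ k := by
      rw [← mul_pow, hq]
      push_cast
      ring
    rw [hneg] at h1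
    have hfac : (k.factorial : ℂ) ≠ 0 := by exact_mod_cast k.factorial_ne_zero
    rw [← add_assoc] at h1
    rw [eq_sub_of_add_eq h1]
    field_simp
  rw [tendsto_nhds_unique (hlim2.congr' heq) hlim1, hlogq]
  ring

/-! ### The inversion t ↦ 1/t -/

theorem image_inv_Ioi_one : (fun t : ℝ => t⁻¹) '' Ioi 1 = Ioo 0 1 := by
  ext t
  simp only [mem_image, mem_Ioi, mem_Ioo]
  constructor
  · rintro ⟨u, hu, rfl⟩
    exact ⟨inv_pos.2 (by linarith), inv_lt_one_of_one_lt₀ hu⟩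
  · rintro ⟨h0, h1⟩
    exact ⟨t⁻¹, (one_lt_inv₀ h0).2 h1, inv_inv t⟩

theorem abs_deriv_inv_smul_exp (a w : ℂ) {t : ℝ} (ht0 : 0 < t) :
    |-(t ^ 2)⁻¹| • Complex.exp ((a - 1) * Real.log t⁻¹ - Real.pi * w * (t⁻¹⁻¹ : ℝ)) =
      Complex.exp ((-a - 1) * Real.log t - Real.pi * w * t) := by
  have h1 : ((|-(t ^ 2)⁻¹| : ℝ) : ℂ) = Complex.exp (-2 * Real.log t) := by
    rw [abs_neg, abs_of_pos (by positivity), ← Real.exp_log (show 0 < (t ^ 2)⁻¹ by positivity),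
      Real.log_inv, Real.log_pow]
    push_cast
    ring_nf
  rw [Complex.real_smul, h1, ← Complex.exp_add, inv_inv, Real.log_inv]
  push_cast
  ring_nf

/-- The sign change of a is the reflection in the functional equation: it is used with a = s - d/2,
the factor t^(-d/2) coming from the Fourier transform of a Gaussian. -/
theorem integral_Ioc_inv_eq_upperGamma (a w : ℂ) :
    ∫ t in Ioc (0 : ℝ) 1, Complex.exp ((a - 1) * Real.log t - Real.pi * w * (t⁻¹ : ℝ)) =
      upperGamma (-a) w := by
  rw [integral_Ioc_eq_integral_Ioo, ← image_inv_Ioi_one,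
    integral_image_eq_integral_abs_deriv_smul (f' := fun t => -(t ^ 2)⁻¹) measurableSet_Ioi
      (fun t ht => (hasDerivAt_inv (zero_lt_one.trans ht).ne').hasDerivWithinAt)
      inv_injective.injOn, upperGamma]
  exact setIntegral_congr_fun measurableSet_Ioi fun t ht =>
    abs_deriv_inv_smul_exp a w (zero_lt_one.trans ht)

theorem integrableOn_Ioc_inv (a : ℂ) {w : ℂ} (hw : 0 < w.re) :
    IntegrableOn (fun t : ℝ =>
      Complex.exp ((a - 1) * Real.log t - Real.pi * w * (t⁻¹ : ℝ))) (Ioc 0 1) := by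
  rw [integrableOn_Ioc_iff_integrableOn_Ioo, ← image_inv_Ioi_one,
    integrableOn_image_iff_integrableOn_abs_deriv_smul (f' := fun t => -(t ^ 2)⁻¹)
      measurableSet_Ioi
      (fun t ht => (hasDerivAt_inv (zero_lt_one.trans ht).ne').hasDerivWithinAt)
      inv_injective.injOn]
  exact (integrableOn_upperGamma (-a) hw).congr_fun (fun t ht =>
    (abs_deriv_inv_smul_exp a w (zero_lt_one.trans ht)).symm) measurableSet_Ioi

/-! ### Poisson summation on ℤ^d -/

/-- The character `exp (- 2 π i m ⬝ θ)` of real `d`-space. -/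
noncomputable def torusChar (m : Fin d → ℤ) (θ : Fin d → ℝ) : ℂ :=
  Complex.exp (-(2 * Real.pi * Complex.I * ∑ i, (m i : ℂ) * θ i))

theorem mFourier_neg_coe (m : Fin d → ℤ) (θ : Fin d → ℝ) :
    UnitAddTorus.mFourier (-m) (fun i => (θ i : UnitAddCircle)) = torusChar m θ := by
  simp only [UnitAddTorus.mFourier, ContinuousMap.coe_mk, fourier_coe_apply, torusChar,
    ← Complex.exp_sum]
  congr 1
  rw [Finset.mul_sum, ← Finset.sum_neg_distrib]
  refine Finset.sum_congr rfl fun i _ => ?_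
  simp only [Pi.neg_apply, Complex.ofReal_one, div_one]
  push_cast
  ring

theorem norm_torusChar (m : Fin d → ℤ) (θ : Fin d → ℝ) : ‖torusChar m θ‖ = 1 := by
  rw [torusChar, Complex.norm_exp]
  simp [← Complex.ofReal_intCast, ← Complex.ofReal_mul]

theorem continuous_torusChar (m : Fin d → ℤ) : Continuous (torusChar m) := by
  unfold torusChar
  fun_prop

theorem torusChar_add_intCast (m n : Fin d → ℤ) (θ : Fin d → ℝ) :
    torusChar m (θ + fun i => (n i : ℝ)) = torusChar m θ := by
  rw [torusChar, torusChar, Complex.exp_eq_exp_iff_exists_int]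
  refine ⟨-∑ i, m i * n i, ?_⟩
  simp only [Pi.add_apply, Complex.ofReal_add, mul_add, Finset.sum_add_distrib]
  push_cast
  ring

/-- The half-open unit cube with upper corner included. -/
def unitCube (d : ℕ) : Set (Fin d → ℝ) := {θ | ∀ i, θ i ∈ Ioc (0 : ℝ) (0 + 1)}

theorem measurableSet_unitCube : MeasurableSet (unitCube d) :=
  MeasurableSet.univ_pi' fun _ => measurableSet_Ioc

theorem norm_le_of_mem_unitCube {θ : Fin d → ℝ} (hθ : θ ∈ unitCube d) : ‖θ‖ ≤ 1 := by
  refine (pi_norm_le_iff_of_nonneg zero_le_one).2 fun i => ?_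
  have := hθ i
  rw [Real.norm_of_nonneg this.1.le]
  linarith [this.2]

theorem isFiniteMeasure_restrict_unitCube :
    IsFiniteMeasure (volume.restrict (unitCube d)) := by
  refine ⟨?_⟩
  rw [Measure.restrict_apply_univ]
  refine (measure_mono fun θ hθ => ?_).trans_lt (measure_closedBall_lt_top (x := 0) (r := 1))
  rw [mem_closedBall_zero_iff]
  exact norm_le_of_mem_unitCube hθ

/-- Integrals over real `d`-space are sums of integrals over the unit cube. -/
theorem hasSum_integral_unitCube {h : (Fin d → ℝ) → ℂ} (hint : Integrable h) :
    HasSum (fun n : Fin d → ℤ => ∫ θ in unitCube d, h (θ + fun i => (n i : ℝ))) (∫ θ, h θ) := by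
  set S : (Fin d → ℤ) → Set (Fin d → ℝ) := fun n =>
    (fun θ : Fin d → ℝ => θ + fun i => (-(n i) : ℝ)) ⁻¹' unitCube d with hS
  have hm : ∀ n, MeasurableSet (S n) := fun n =>
    measurableSet_unitCube.preimage (measurable_id.add_const _)
  have hmem : ∀ n θ, θ ∈ S n ↔ ∀ i, θ i + -(n i) ∈ Ioc (0 : ℝ) (0 + 1) := fun n θ => Iff.rfl
  have hd : Pairwise (Function.onFun Disjoint S) := by
    intro n m hnm
    refine Set.disjoint_left.2 fun θ h1 h2 => hnm (funext fun i => ?_)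
    have a := (hmem n θ).1 h1 i
    have b := (hmem m θ).1 h2 i
    have h3 : (n i : ℝ) < m i + 1 := by linarith [a.1, b.2]
    have h4 : (m i : ℝ) < n i + 1 := by linarith [a.2, b.1]
    have h3' : n i < m i + 1 := by exact_mod_cast h3
    have h4' : m i < n i + 1 := by exact_mod_cast h4
    omega
  have hU : ⋃ n, S n = univ := by
    -- The cells are open below and closed above, hence the ceiling minus one.
    refine eq_univ_of_forall fun θ => mem_iUnion.2 ⟨fun i => ⌈θ i⌉ - 1, fun i => ?_⟩
    have h1 := Int.ceil_lt_add_one (θ i)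
    have h2 := Int.le_ceil (θ i)
    constructor <;> simp only [Pi.add_apply] <;> push_cast <;> linarith
  have h1 := hasSum_integral_iUnion hm hd (f := h) (μ := volume) hint.integrableOn
  rw [hU, setIntegral_univ] at h1
  refine h1.congr_fun fun n => ?_
  have h2 := (measurePreserving_add_right volume (fun i => (-(n i) : ℝ))).setIntegral_preimage_emb
    (measurableEmbedding_addRight _) (fun θ => h (θ + fun i => (n i : ℝ))) (unitCube d)
  rw [← h2]
  refine setIntegral_congr_fun (hm n) fun θ _ => ?_
  have : (θ + fun i => (-(n i) : ℝ)) + (fun i => (n i : ℝ)) = θ := by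
    ext i; simp
  simp only [this]

theorem isOpenQuotientMap_torus :
    IsOpenQuotientMap fun (θ : Fin d → ℝ) (i : Fin d) => (θ i : UnitAddCircle) :=
  IsOpenQuotientMap.piMap fun _ => QuotientAddGroup.isOpenQuotientMap_mk

/-- The `d`-dimensional Poisson summation formula for locally normally convergent
periodisations. -/
theorem tsum_eq_tsum_integral_torusChar {g : (Fin d → ℝ) → ℂ} (hg : Continuous g)
    (hloc : ∀ R : ℝ, ∃ u : (Fin d → ℤ) → ℝ, Summable u ∧
      ∀ n θ, ‖θ‖ ≤ R → ‖g (θ + fun i => (n i : ℝ))‖ ≤ u n)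
    (hint : Integrable g) (hsum : Summable fun m : Fin d → ℤ => ∫ θ, torusChar m θ * g θ) :
    ∑' n : Fin d → ℤ, g (fun i => (n i : ℝ)) = ∑' m : Fin d → ℤ, ∫ θ, torusChar m θ * g θ := by
  set P : (Fin d → ℝ) → ℂ := fun θ => ∑' n : Fin d → ℤ, g (θ + fun i => (n i : ℝ)) with hP
  have hPc : Continuous P := by
    refine continuous_iff_continuousAt.2 fun θ₀ => ?_
    obtain ⟨u, hu, hgu⟩ := hloc (‖θ₀‖ + 1)
    have h1 : ContinuousOn P (closedBall 0 (‖θ₀‖ + 1)) :=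
      continuousOn_tsum (fun n => (hg.comp (continuous_id.add continuous_const)).continuousOn) hu
        fun n θ hθ => hgu n θ (by simpa using hθ)
    refine h1.continuousAt (Filter.mem_of_superset
      (isOpen_ball.mem_nhds (x := θ₀) ?_) ball_subset_closedBall)
    simp
  have hPper : ∀ θ (m : Fin d → ℤ), P (θ + fun i => (m i : ℝ)) = P θ := by
    intro θ m
    show ∑' n : Fin d → ℤ, g ((θ + fun i => (m i : ℝ)) + fun i => (n i : ℝ)) =
      ∑' n : Fin d → ℤ, g (θ + fun i => (n i : ℝ))
    rw [← (Equiv.addLeft m).tsum_eq fun n : Fin d → ℤ => g (θ + fun i => (n i : ℝ))]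
    refine tsum_congr fun n => congrArg g ?_
    ext i
    simp [add_assoc]
  set q : (Fin d → ℝ) → UnitAddTorus (Fin d) := fun θ i => (θ i : UnitAddCircle) with hq
  have hqo : IsOpenQuotientMap q := isOpenQuotientMap_torus
  -- The periodisation is constant on the fibres of the quotient map, so it descends to a continuous
  -- function on the torus.
  have hPq : ∀ θ θ', q θ = q θ' → P θ = P θ' := by
    intro θ θ' h
    have : ∀ i, ∃ n : ℤ, θ' i - θ i = n := fun i => by
      have := congrFun h i
      obtain ⟨n, hn⟩ := AddSubgroup.mem_zmultiples_iff.1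
        (QuotientAddGroup.leftRel_apply.1 (Quotient.exact this))
      refine ⟨n, ?_⟩
      rw [← neg_add_eq_sub, ← hn]
      simp
    choose m hm using this
    rw [← hPper θ m]
    congr 1
    ext i
    simp [← hm]
  let F : C(UnitAddTorus (Fin d), ℂ) :=
    ⟨fun x => P (Function.surjInv hqo.surjective x), by
      rw [hqo.isQuotientMap.continuous_iff]
      convert hPc using 1
      ext θ
      exact hPq _ _ (Function.surjInv_eq hqo.surjective (q θ))⟩
  have hFq : ∀ θ, F (q θ) = P θ := fun θ => hPq _ _ (Function.surjInv_eq hqo.surjective (q θ))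
  -- Unfolding: the characters are periodic, so the cube integral of the periodisation is an
  -- integral of g over the whole space.
  have hcoeff : ∀ m, UnitAddTorus.mFourierCoeff F m = ∫ θ, torusChar m θ * g θ := by
    intro m
    have hintm : Integrable fun θ => torusChar m θ * g θ :=
      hint.bdd_mul (continuous_torusChar m).aestronglyMeasurable (c := 1)
        (ae_of_all _ fun θ => (norm_torusChar m θ).le)
    rw [← (hasSum_integral_unitCube hintm).tsum_eq, UnitAddTorus.mFourierCoeff_eq_integral _ _ 0]
    simp only [mFourier_neg_coe]
    obtain ⟨u, hu, hgu⟩ := hloc 1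
    have hfin := isFiniteMeasure_restrict_unitCube (d := d)
    have hbd : ∀ n : Fin d → ℤ, ∀ᵐ θ ∂(volume.restrict (unitCube d)),
        ‖torusChar m (θ + fun i => (n i : ℝ)) * g (θ + fun i => (n i : ℝ))‖ ≤ u n := fun n => by
      filter_upwards [ae_restrict_mem measurableSet_unitCube] with θ hθ
      rw [norm_mul, norm_torusChar, one_mul]
      exact hgu n θ (norm_le_of_mem_unitCube hθ)
    rw [integral_tsum_of_summable_integral_norm]
    · refine setIntegral_congr_fun measurableSet_unitCube fun θ _ => ?_
      simp only [torusChar_add_intCast]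
      rw [tsum_mul_left, smul_eq_mul]
      exact congrArg _ (hFq θ)
    · intro n
      refine Integrable.of_bound ?_ (u n) (hbd n)
      exact (((continuous_torusChar m).mul hg).comp
        (continuous_id.add continuous_const)).aestronglyMeasurable
    · refine Summable.of_nonneg_of_le (fun n => integral_nonneg fun θ => norm_nonneg _)
        (fun n => integral_mono_of_nonneg (ae_of_all _ fun θ => norm_nonneg _)
          (integrable_const (u n)) (hbd n)) ?_
      simp only [integral_const]
      exact hu.const_smul _
  have hsum' : Summable (UnitAddTorus.mFourierCoeff F) := by
    rw [funext hcoeff]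
    exact hsum
  -- Summable coefficients make the Fourier series converge pointwise; evaluation at 0 is the claim.
  have h := (UnitAddTorus.hasSum_mFourier_series_apply_of_summable hsum' 0).tsum_eq
  have h0 : q 0 = 0 := rfl
  rw [← h0, hFq] at h
  simp only [hcoeff] at h
  rw [hP] at h
  simp only [zero_add] at h
  rw [← h]
  refine tsum_congr fun m => ?_
  have := mFourier_neg_coe (-m) 0
  rw [neg_neg] at this
  rw [hq, this]
  simp [torusChar]

/-! ### Gaussians on a general lattice -/

theorem exp_neg_mul_norm_sub_sq_le {b M : ℝ} (hb : 0 ≤ b) {x : RSpace d} (hx : ‖x‖ ≤ M)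
    (z : RSpace d) :
    Real.exp (-(b * ‖x - z‖ ^ 2)) ≤ Real.exp (2 * b * M * ‖z‖ - b * ‖z‖ ^ 2) := by
  refine Real.exp_le_exp.2 ?_
  have h1 := real_inner_le_norm x z
  rw [norm_sub_sq_real]
  have h2 := mul_le_mul_of_nonneg_right hx (norm_nonneg z)
  have h3 : b * inner ℝ x z ≤ b * (M * ‖z‖) := mul_le_mul_of_nonneg_left (h1.trans h2) hb
  have h4 : 0 ≤ b * ‖x‖ ^ 2 := by positivity
  nlinarith

theorem summable_lattice_exp_neg_mul_norm_sub_sq (B : Matrix (Fin d) (Fin d) ℝ) (hB : B.det ≠ 0)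
    {L : Set (RSpace d)} (hL : L ⊆ lattice B) {b : ℝ} (hb : 0 < b) (x : RSpace d) :
    Summable fun z : L => Real.exp (-(b * ‖x - (z : RSpace d)‖ ^ 2)) := by
  have h := summable_lattice_gaussian B hB hL (2 * b * ‖x‖) hb
  refine Summable.of_nonneg_of_le (fun _ => (Real.exp_pos _).le) (fun z => ?_) h
  exact exp_neg_mul_norm_sub_sq_le hb.le le_rfl (z : RSpace d)

/-- The integer coordinates of lattice points. -/
noncomputable def latticeEquiv (B : Matrix (Fin d) (Fin d) ℝ) (hB : B.det ≠ 0) :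
    (Fin d → ℤ) ≃ lattice B :=
  Equiv.ofInjective _ fun m n h => by
    have h1 := Matrix.mulVec_injective_of_det_ne_zero hB (WithLp.toLp_injective 2 h)
    exact funext fun i => by exact_mod_cast congrFun h1 i

theorem coe_latticeEquiv (B : Matrix (Fin d) (Fin d) ℝ) (hB : B.det ≠ 0) (n : Fin d → ℤ) :
    (latticeEquiv B hB n : RSpace d) = WithLp.toLp 2 (B.mulVec fun i => (n i : ℝ)) := rfl

theorem coe_latticeEquiv_neg (B : Matrix (Fin d) (Fin d) ℝ) (hB : B.det ≠ 0) (n : Fin d → ℤ) :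
    (latticeEquiv B hB (-n) : RSpace d) = -(latticeEquiv B hB n : RSpace d) := by
  rw [coe_latticeEquiv, coe_latticeEquiv, ← WithLp.toLp_neg, ← Matrix.mulVec_neg]
  congr 2
  ext i
  simp

theorem det_inv_transpose_ne_zero {A : Matrix (Fin d) (Fin d) ℝ} (hA : A.det ≠ 0) :
    (A⁻¹).transpose.det ≠ 0 := by
  rw [Matrix.det_transpose]
  exact (Matrix.isUnit_nonsing_inv_det A hA.isUnit).ne_zero

theorem continuous_toLp_mulVec (A : Matrix (Fin d) (Fin d) ℝ) :
    Continuous fun θ : Fin d → ℝ => (WithLp.toLp 2 (A.mulVec θ) : RSpace d) := by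
  have : Continuous fun θ : Fin d → ℝ => A.mulVec θ :=
    Continuous.matrix_mulVec continuous_const continuous_id
  exact (PiLp.continuous_toLp 2 _).comp this

theorem measurePreserving_toLp_mulVec {A : Matrix (Fin d) (Fin d) ℝ} (hA : A.det ≠ 0) :
    MeasurePreserving (fun θ : Fin d → ℝ => (WithLp.toLp 2 (A.mulVec θ) : RSpace d)) volume
      (ENNReal.ofReal |A.det⁻¹| • volume) := by
  have h1 : MeasurePreserving (Matrix.toLin' A) volume
      (ENNReal.ofReal |A.det⁻¹| • (volume : Measure (Fin d → ℝ))) :=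
    ⟨(LinearMap.continuous_of_finiteDimensional _).measurable,
      Real.map_matrix_volume_pi_eq_smul_volume_pi hA⟩
  have h2 := (PiLp.volume_preserving_toLp (Fin d)).smul_measure (ENNReal.ofReal |A.det⁻¹|)
  exact h2.comp h1

theorem measurableEmbedding_toLp_mulVec {A : Matrix (Fin d) (Fin d) ℝ} (hA : A.det ≠ 0) :
    MeasurableEmbedding (fun θ : Fin d → ℝ => (WithLp.toLp 2 (A.mulVec θ) : RSpace d)) :=
  (continuous_toLp_mulVec A).measurableEmbedding fun _ _ h =>
    Matrix.mulVec_injective_of_det_ne_zero hA (WithLp.toLp_injective 2 h)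

theorem integral_toLp_mulVec {A : Matrix (Fin d) (Fin d) ℝ} (hA : A.det ≠ 0) (f : RSpace d → ℂ) :
    ∫ θ : Fin d → ℝ, f (WithLp.toLp 2 (A.mulVec θ)) = ((|A.det|⁻¹ : ℝ) : ℂ) * ∫ p, f p := by
  rw [(measurePreserving_toLp_mulVec hA).integral_comp (measurableEmbedding_toLp_mulVec hA),
    integral_smul_measure, ENNReal.toReal_ofReal (abs_nonneg _), abs_inv, Complex.real_smul]

theorem integrable_toLp_mulVec {A : Matrix (Fin d) (Fin d) ℝ} (hA : A.det ≠ 0) {f : RSpace d → ℂ}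
    (hf : Integrable f) : Integrable fun θ : Fin d → ℝ => f (WithLp.toLp 2 (A.mulVec θ)) :=
  ((measurePreserving_toLp_mulVec hA).integrable_comp_emb (measurableEmbedding_toLp_mulVec hA)).2
    (hf.smul_measure ENNReal.ofReal_ne_top)

theorem inner_inv_transpose_mulVec {A : Matrix (Fin d) (Fin d) ℝ} (hA : A.det ≠ 0)
    (m θ : Fin d → ℝ) :
    inner ℝ (WithLp.toLp 2 ((A⁻¹).transpose.mulVec m) : RSpace d) (WithLp.toLp 2 (A.mulVec θ)) =
      ∑ i, m i * θ i := by
  rw [EuclideanSpace.inner_toLp_toLp, star_trivial, dotProduct_comm, Matrix.dotProduct_mulVec,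
    Matrix.vecMul_mulVec, Matrix.transpose_transpose, Matrix.nonsing_inv_mul _ hA.isUnit,
    Matrix.vecMul_one]
  rfl

theorem torusChar_eq {A : Matrix (Fin d) (Fin d) ℝ} (hA : A.det ≠ 0) (m : Fin d → ℤ)
    (θ : Fin d → ℝ) :
    torusChar m θ = Complex.exp (-(2 * Real.pi * Complex.I *
      (inner ℝ (latticeEquiv _ (det_inv_transpose_ne_zero hA) m : RSpace d)
        (WithLp.toLp 2 (A.mulVec θ)) : ℝ))) := by
  rw [coe_latticeEquiv, inner_inv_transpose_mulVec hA, torusChar]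
  push_cast
  rfl

/-- A shifted and modulated Gaussian. -/
noncomputable def modGaussian (t : ℝ) (x y p : RSpace d) : ℂ :=
  Complex.exp (-(Real.pi * t * ((‖x - p‖ ^ 2 : ℝ) : ℂ)) -
    2 * Real.pi * Complex.I * (inner ℝ y p : ℝ))

theorem norm_modGaussian (t : ℝ) (x y p : RSpace d) :
    ‖modGaussian t x y p‖ = Real.exp (-(Real.pi * t * ‖x - p‖ ^ 2)) := by
  rw [modGaussian, Complex.norm_exp]
  congr 1
  simp [-Complex.ofReal_pow]

theorem continuous_modGaussian (t : ℝ) (x y : RSpace d) : Continuous (modGaussian t x y) := by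
  unfold modGaussian
  fun_prop

theorem modGaussian_add_self (t : ℝ) (x y v : RSpace d) :
    modGaussian t x y (v + x) = Complex.exp (-(2 * Real.pi * Complex.I * (inner ℝ y x : ℝ))) *
      Complex.exp (-((Real.pi * t : ℝ) : ℂ) * (‖v‖ : ℂ) ^ 2 +
        -(2 * Real.pi * Complex.I) * (inner ℝ y v : ℝ)) := by
  rw [modGaussian, ← Complex.exp_add, inner_add_right, show x - (v + x) = -v by abel, norm_neg]
  congr 1
  push_cast
  ring

theorem integrable_modGaussian {t : ℝ} (ht : 0 < t) (x y : RSpace d) :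
    Integrable (modGaussian t x y) := by
  have h : Integrable fun v => modGaussian t x y (v + x) := by
    simp only [modGaussian_add_self]
    exact (GaussianFourier.integrable_cexp_neg_mul_sq_norm_add
      (by simpa using mul_pos Real.pi_pos ht) _ _).const_mul _
  simpa using h.comp_sub_right x

/-- Translation by x centres the Gaussian. Powers of t are kept as exponentials of log t, so that
later products only add exponents. -/
theorem integral_modGaussian {t : ℝ} (ht : 0 < t) (x y : RSpace d) :
    ∫ p, modGaussian t x y p = Complex.exp (-(d / 2 : ℂ) * Real.log t) *
      Complex.exp (-(Real.pi * ((‖y‖ ^ 2 : ℝ) : ℂ) * (t⁻¹ : ℝ)) -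
        2 * Real.pi * Complex.I * (inner ℝ y x : ℝ)) := by
  rw [← integral_add_right_eq_self _ x]
  simp only [modGaussian_add_self]
  rw [integral_const_mul, GaussianFourier.integral_cexp_neg_mul_sq_norm_add
    (by simpa using mul_pos Real.pi_pos ht)]
  have hπ : (Real.pi : ℂ) ≠ 0 := Complex.ofReal_ne_zero.2 Real.pi_ne_zero
  have ht0 : (t : ℂ) ≠ 0 := Complex.ofReal_ne_zero.2 ht.ne'
  have h1 : (Real.pi : ℂ) / ((Real.pi * t : ℝ) : ℂ) = ((t⁻¹ : ℝ) : ℂ) := by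
    push_cast
    field_simp
  rw [h1, finrank_euclideanSpace_fin, Complex.cpow_def_of_ne_zero
    (Complex.ofReal_ne_zero.2 (inv_pos.2 ht).ne'), ← Complex.ofReal_log (inv_pos.2 ht).le,
    Real.log_inv, ← Complex.exp_add, ← Complex.exp_add, ← Complex.exp_add]
  congr 1
  have hI : Complex.I ^ 2 = -1 := Complex.I_sq
  push_cast
  field_simp
  rw [hI]
  ring

theorem exp_mul_modGaussian (t : ℝ) (x y k p : RSpace d) :
    Complex.exp (-(2 * Real.pi * Complex.I * (inner ℝ k p : ℝ))) * modGaussian t x y p =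
      modGaussian t x (y + k) p := by
  rw [modGaussian, modGaussian, ← Complex.exp_add, inner_add_left]
  congr 1
  push_cast
  ring

/-- Poisson summation for Gaussians on a lattice. -/
theorem tsum_modGaussian {A : Matrix (Fin d) (Fin d) ℝ} (hA : A.det ≠ 0) {t : ℝ} (ht : 0 < t)
    (x y : RSpace d) :
    ∑' z : lattice A, modGaussian t x y z =
      ((|A.det|⁻¹ : ℝ) : ℂ) * Complex.exp (-(d / 2 : ℂ) * Real.log t) *
        ∑' k : reciprocalLattice A,
          Complex.exp (-(Real.pi * ((‖y - k‖ ^ 2 : ℝ) : ℂ) * (t⁻¹ : ℝ)) -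
            2 * Real.pi * Complex.I * (inner ℝ (y - k) x : ℝ)) := by
  have hA' := det_inv_transpose_ne_zero hA
  have hπ := Real.pi_pos
  set g : (Fin d → ℝ) → ℂ := fun θ => modGaussian t x y (WithLp.toLp 2 (A.mulVec θ)) with hg
  have hgc : Continuous g := (continuous_modGaussian t x y).comp (continuous_toLp_mulVec A)
  have hcoef : ∀ m : Fin d → ℤ, ∫ θ, torusChar m θ * g θ =
      ((|A.det|⁻¹ : ℝ) : ℂ) * Complex.exp (-(d / 2 : ℂ) * Real.log t) *
          Complex.exp (-(Real.pi * ((‖y + latticeEquiv _ hA' m‖ ^ 2 : ℝ) : ℂ) * (t⁻¹ : ℝ)) -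
            2 * Real.pi * Complex.I * (inner ℝ (y + latticeEquiv _ hA' m) x : ℝ)) := by
    intro m
    simp only [torusChar_eq hA, hg, exp_mul_modGaussian]
    rw [integral_toLp_mulVec hA, integral_modGaussian ht, ← mul_assoc]
  have hsum : Summable fun m : Fin d → ℤ => ∫ θ, torusChar m θ * g θ := by
    simp only [hcoef]
    refine Summable.mul_left _ (Summable.of_norm ?_)
    have h := (latticeEquiv _ hA').summable_iff.2 (summable_lattice_exp_neg_mul_norm_sub_sq _ hA'
      Subset.rfl (b := Real.pi * t⁻¹) (by positivity) (-y))
    refine h.congr fun m => ?_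
    rw [Complex.norm_exp, Function.comp_apply, ← neg_add', norm_neg]
    congr 1
    simp [-Complex.ofReal_pow]
    ring
  have hloc : ∀ R : ℝ, ∃ u : (Fin d → ℤ) → ℝ, Summable u ∧
      ∀ n θ, ‖θ‖ ≤ R → ‖g (θ + fun i => (n i : ℝ))‖ ≤ u n := by
    intro R
    obtain ⟨M, hM⟩ := (isCompact_closedBall (0 : Fin d → ℝ) R).exists_bound_of_continuousOn
      (f := fun θ => x - (WithLp.toLp 2 (A.mulVec θ) : RSpace d))
      (continuous_const.sub (continuous_toLp_mulVec A)).continuousOn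
    refine ⟨_, (latticeEquiv A hA).summable_iff.2
      (summable_lattice_gaussian A hA Subset.rfl (2 * (Real.pi * t) * M)
        (c := Real.pi * t) (by positivity)), fun n θ hθ => ?_⟩
    have h := exp_neg_mul_norm_sub_sq_le (b := Real.pi * t) (by positivity)
      (hM θ (by simpa using hθ)) (latticeEquiv A hA n : RSpace d)
    refine le_trans (le_of_eq ?_) h
    rw [hg]
    simp only [norm_modGaussian]
    rw [Matrix.mulVec_add, WithLp.toLp_add, coe_latticeEquiv, sub_sub]
  have h := tsum_eq_tsum_integral_torusChar hgc hloc
    (integrable_toLp_mulVec hA (integrable_modGaussian ht x y)) hsum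
  rw [← (latticeEquiv A hA).tsum_eq fun z : lattice A => modGaussian t x y z]
  refine h.trans ?_
  simp only [hcoef]
  rw [tsum_mul_left]
  congr 1
  -- Poisson summation produces the shifts y + k; the reflection m ↦ -m turns them into y - k.
  rw [show (∑' k : reciprocalLattice A,
    Complex.exp (-(Real.pi * ((‖y - k‖ ^ 2 : ℝ) : ℂ) * (t⁻¹ : ℝ)) -
            2 * Real.pi * Complex.I * (inner ℝ (y - k) x : ℝ))) = _ from
    ((latticeEquiv _ hA').tsum_eq fun k : reciprocalLattice A =>
      Complex.exp (-(Real.pi * ((‖y - k‖ ^ 2 : ℝ) : ℂ) * (t⁻¹ : ℝ)) -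
            2 * Real.pi * Complex.I * (inner ℝ (y - k) x : ℝ))).symm,
    ← (Equiv.neg (Fin d → ℤ)).tsum_eq]
  refine tsum_congr fun m => ?_
  simp only [Equiv.neg_apply, coe_latticeEquiv_neg, ← sub_eq_add_neg]

/-! ### Holomorphy of lattice sums of incomplete gamma functions -/

/-- The terms of `gammaSum`. -/
noncomputable def gammaTerm (z : RSpace d) (p : ℂ × CSpace d × CSpace d) : ℂ :=
  Complex.exp (2 * Real.pi * Complex.I * bilin p.2.2 (ofRealVec z)) *
    upperGamma p.1 (bilin (p.2.1 - ofRealVec z) (p.2.1 - ofRealVec z))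

/-- Lattice sums of incomplete gamma functions, the building blocks of the Epstein zeta
function. -/
noncomputable def gammaSum (L : Set (RSpace d)) (p : ℂ × CSpace d × CSpace d) : ℂ :=
  ∑' z : L, gammaTerm z p

theorem re_bilin_sub_self (u : CSpace d) (z : RSpace d) :
    (bilin (u - ofRealVec z) (u - ofRealVec z)).re = ‖reVec u - z‖ ^ 2 - ‖imVec u‖ ^ 2 := by
  rw [re_bilin_self, reVec_sub, imVec_sub, reVec_ofRealVec, imVec_ofRealVec, sub_zero]

theorem re_bilin_sub_self_pos {L : Set (RSpace d)} {u : CSpace d} (hu : u ∈ coneDomain L)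
    {z : RSpace d} (hz : z ∈ L) : 0 < (bilin (u - ofRealVec z) (u - ofRealVec z)).re := by
  rw [re_bilin_sub_self, sub_pos]
  exact pow_lt_pow_left₀ (hu z hz) (norm_nonneg _) two_ne_zero

theorem norm_exp_bilin_le (v : CSpace d) (z : RSpace d) :
    ‖Complex.exp (2 * Real.pi * Complex.I * bilin v (ofRealVec z))‖ ≤
      Real.exp (2 * Real.pi * ‖v‖ * ‖z‖) := by
  have h1 : (2 * Real.pi * Complex.I * bilin v (ofRealVec z)).re =
      -(2 * Real.pi * inner ℝ (imVec v) z) := by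
    rw [← im_bilin_ofRealVec]
    simp [Complex.mul_re]
  rw [Complex.norm_exp, h1, Real.exp_le_exp]
  have h2 := (abs_le.1 ((abs_real_inner_le_norm (imVec v) z).trans
    (mul_le_mul_of_nonneg_right (norm_imVec_le v) (norm_nonneg z)))).1
  nlinarith [Real.pi_pos]

/-- The uniform cone gap keeps Re w ≥ η², so one constant bounds every `upperGamma`. With |u| ≤ M
also Re w ≥ |z|² - 2M|z| - M², and the resulting Gaussian decay beats the growth exp(2π|v||z|) of
the complexified character. -/
theorem exists_summable_gammaTerm_bound (B : Matrix (Fin d) (Fin d) ℝ) (hB : B.det ≠ 0)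
    {L : Set (RSpace d)} (hL : L ⊆ lattice B) {p₀ : ℂ × CSpace d × CSpace d}
    (hp : p₀.2.1 ∈ coneDomain L) :
    ∃ V ∈ 𝓝 p₀, ∃ b : L → ℝ, Summable b ∧ ∀ z : L, ∀ p ∈ V, ‖gammaTerm (z : RSpace d) p‖ ≤ b z := by
  obtain ⟨s₀, u₀, v₀⟩ := p₀
  obtain ⟨η, hη, hgap⟩ := exists_gap_of_mem_coneDomain B hB hL hp
  obtain ⟨C, hC, hG⟩ := exists_norm_upperGamma_le (s₀.re + 1) (c := η ^ 2) (by positivity)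
  have hπ := Real.pi_pos
  set M := ‖u₀‖ + η with hM
  have hM0 : 0 ≤ M := by positivity
  have hsum := (summable_lattice_gaussian B hB hL
    (2 * Real.pi * (‖v₀‖ + 1) + 2 * Real.pi * M) hπ).mul_left (C * Real.exp (Real.pi * M ^ 2))
  refine ⟨ball s₀ 1 ×ˢ ball u₀ η ×ˢ ball v₀ 1, prod_mem_nhds (ball_mem_nhds _ one_pos)
    (prod_mem_nhds (ball_mem_nhds _ hη) (ball_mem_nhds _ one_pos)), _, hsum, ?_⟩
  rintro z ⟨s, u, v⟩ ⟨hs, hu, hv⟩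
  simp only [mem_ball, dist_eq_norm] at hs hv
  have hs' : s.re ≤ s₀.re + 1 := by
    have := (Complex.abs_re_le_norm (s - s₀)).trans hs.le
    rw [Complex.sub_re] at this
    linarith [(abs_le.1 this).2]
  have hv' : ‖v‖ ≤ ‖v₀‖ + 1 := by linarith [norm_sub_norm_le v v₀]
  have hu' : ‖u‖ ≤ M := by
    have h := hu
    simp only [mem_ball, dist_eq_norm] at h
    linarith [norm_sub_norm_le u u₀]
  have hz := hgap u hu z z.2
  have hw := re_bilin_sub_self u (z : RSpace d)
  have him : 0 ≤ ‖imVec u‖ := norm_nonneg _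
  have hw1 : η ^ 2 ≤ (bilin (u - ofRealVec (z : RSpace d)) (u - ofRealVec (z : RSpace d))).re := by
    rw [hw]
    nlinarith
  have hw2 : ‖(z : RSpace d)‖ ^ 2 - 2 * M * ‖(z : RSpace d)‖ - M ^ 2 ≤
      (bilin (u - ofRealVec (z : RSpace d)) (u - ofRealVec (z : RSpace d))).re := by
    rw [hw, norm_sub_sq_real]
    have h1 := real_inner_le_norm (reVec u) (z : RSpace d)
    have h2 := mul_le_mul_of_nonneg_right ((norm_reVec_le u).trans hu') (norm_nonneg (z : RSpace d))
    have h3 : ‖imVec u‖ ^ 2 ≤ M ^ 2 :=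
      pow_le_pow_left₀ him ((norm_imVec_le u).trans hu') 2
    nlinarith [sq_nonneg ‖reVec u‖]
  have hG' := hG s _ hs' hw1
  rw [gammaTerm, norm_mul]
  refine (mul_le_mul (norm_exp_bilin_le v z) hG' (norm_nonneg _) (Real.exp_pos _).le).trans ?_
  rw [mul_left_comm, mul_assoc C, ← Real.exp_add, ← Real.exp_add]
  refine mul_le_mul_of_nonneg_left (Real.exp_le_exp.2 ?_) hC
  have h4 := mul_le_mul_of_nonneg_left hw2 hπ.le
  have h5 := mul_le_mul_of_nonneg_right (mul_le_mul_of_nonneg_left hv'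
    (by positivity : 0 ≤ 2 * Real.pi)) (norm_nonneg (z : RSpace d))
  linarith

theorem summable_gammaTerm (B : Matrix (Fin d) (Fin d) ℝ) (hB : B.det ≠ 0)
    {L : Set (RSpace d)} (hL : L ⊆ lattice B) {p : ℂ × CSpace d × CSpace d}
    (hp : p.2.1 ∈ coneDomain L) : Summable fun z : L => gammaTerm (z : RSpace d) p := by
  obtain ⟨V, hV, b, hb, h⟩ := exists_summable_gammaTerm_bound B hB hL hp
  exact Summable.of_norm_bounded hb fun z => h z p (mem_of_mem_nhds hV)

theorem differentiableOn_gammaSum (B : Matrix (Fin d) (Fin d) ℝ) (hB : B.det ≠ 0)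
    {L : Set (RSpace d)} (hL : L ⊆ lattice B) :
    DifferentiableOn ℂ (gammaSum L) {p : ℂ × CSpace d × CSpace d | p.2.1 ∈ coneDomain L} := by
  refine differentiableOn_tsum_of_locally_bounded
    ((isOpen_coneDomain B hB hL).preimage (continuous_fst.comp continuous_snd)) (fun z => ?_)
    fun p hp => exists_summable_gammaTerm_bound B hB hL hp
  refine DifferentiableOn.mul ?_ ?_
  · refine Differentiable.differentiableOn (Differentiable.cexp (Differentiable.const_mul ?_ _))
    exact differentiable_bilin (by fun_prop) (by fun_prop)
  · refine differentiableOn_upperGamma.comp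
      (f := fun p : ℂ × CSpace d × CSpace d =>
        (p.1, bilin (p.2.1 - ofRealVec (z : RSpace d)) (p.2.1 - ofRealVec (z : RSpace d))))
      (Differentiable.differentiableOn ?_) (fun p hp => re_bilin_sub_self_pos hp z.2)
    have h1 : Differentiable ℂ fun p : ℂ × CSpace d × CSpace d =>
      p.2.1 - ofRealVec (z : RSpace d) := by fun_prop
    exact differentiable_fst.prodMk (differentiable_bilin h1 h1)

/-! ### Incomplete gamma representation in the half-plane of convergence -/

-- Mediates between the zeta sum, which omits z = x, and Poisson summation, which needs every
-- lattice point.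
open Classical in
theorem hasSum_of_hasSum_sdiff_singleton {α M : Type*} [AddCommMonoid M] [TopologicalSpace M]
    [ContinuousAdd M] {f : α → M} {S : Set α} {x : α} {a : M}
    (h : HasSum (fun z : ↥(S \ {x}) => f z) a) :
    HasSum (fun z : S => f z) (a + if x ∈ S then f x else 0) := by
  split_ifs with hx
  · have h2 : HasSum (fun z : ({x} : Set α) => f z) (f x) := by
      simpa using hasSum_unique fun z : ({x} : Set α) => f z
    have h3 := HasSum.add_disjoint (f := f) (s := S \ {x}) (t := {x}) disjoint_sdiff_left h h2
    rw [sdiff_union_self, union_eq_self_of_subset_right (singleton_subset_iff.2 hx)] at h3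
    exact h3
  · rw [sdiff_singleton_eq_self hx] at h
    simpa using h

/-- Reduces L¹ norms to the same integrals with real parameters, where the closed formulas apply. -/
theorem integral_norm_cexp_eq {α : Type*} [MeasurableSpace α] (μ : Measure α) (f : α → ℂ) :
    ∫ t, ‖Complex.exp (f t)‖ ∂μ = ‖∫ t, Complex.exp ((f t).re : ℂ) ∂μ‖ := by
  simp only [Complex.norm_exp, ← Complex.ofReal_exp, integral_complex_ofReal, Complex.norm_real]
  rw [Real.norm_of_nonneg (integral_nonneg fun t => (Real.exp_pos _).le)]

theorem ofReal_pi_mul_cpow_neg {r : ℝ} (hr : 0 < r) (s : ℂ) :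
    ((Real.pi * r ^ 2 : ℝ) : ℂ) ^ (-s) = (Real.pi : ℂ) ^ (-s) * (r : ℂ) ^ (-(2 * s)) := by
  have hπ := Real.pi_pos
  rw [Complex.ofReal_mul, Complex.mul_cpow_ofReal_nonneg hπ.le (by positivity)]
  congr 1
  rw [Complex.cpow_def_of_ne_zero (Complex.ofReal_ne_zero.2 (pow_ne_zero 2 hr.ne')),
    Complex.cpow_def_of_ne_zero (Complex.ofReal_ne_zero.2 hr.ne'), ← Complex.ofReal_log
    (by positivity), ← Complex.ofReal_log hr.le, Real.log_pow]
  congr 1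
  push_cast
  ring

theorem upperGamma_eq_gammaTerm (s : ℂ) (x z : RSpace d) :
    upperGamma s ((‖x - z‖ ^ 2 : ℝ) : ℂ) = gammaTerm z (s, ofRealVec x, 0) := by
  rw [gammaTerm]
  simp only [← ofRealVec_sub, bilin_self_ofRealVec]
  simp [bilin]

theorem summable_upperGamma (B : Matrix (Fin d) (Fin d) ℝ) (hB : B.det ≠ 0)
    {L : Set (RSpace d)} (hL : L ⊆ lattice B) (s : ℂ) {x : RSpace d} (hx : x ∉ L) :
    Summable fun z : L => ‖upperGamma s ((‖x - (z : RSpace d)‖ ^ 2 : ℝ) : ℂ)‖ := by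
  simp only [upperGamma_eq_gammaTerm]
  exact (summable_gammaTerm B hB hL (p := (s, ofRealVec x, 0))
    (ofRealVec_mem_coneDomain.2 hx)).norm

/-- The Mellin integral of `modGaussian` over the unit interval. -/
noncomputable def lowerTerm (s : ℂ) (x y z : RSpace d) : ℂ :=
  ∫ t in Ioc (0 : ℝ) 1, Complex.exp ((s - 1) * Real.log t) * modGaussian t x y z

theorem exp_mul_modGaussian_eq (s : ℂ) (x y z : RSpace d) (t : ℝ) :
    Complex.exp ((s - 1) * Real.log t) * modGaussian t x y z =
      Complex.exp (-(2 * Real.pi * Complex.I * (inner ℝ y z : ℝ))) *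
        Complex.exp ((s - 1) * Real.log t - Real.pi * ((‖x - z‖ ^ 2 : ℝ) : ℂ) * t) := by
  rw [modGaussian, ← Complex.exp_add, ← Complex.exp_add]
  congr 1
  ring

theorem norm_exp_neg_I_mul_ofReal (r : ℝ) :
    ‖Complex.exp (-(2 * Real.pi * Complex.I * (r : ℂ)))‖ = 1 := by
  rw [Complex.norm_exp]
  simp

/-- The part over (0, 1) is the complete integral minus the upper one. The former is a multiple of
|x-z|^(-2 Re s), summable since 2 Re s > d; the latter decays like a Gaussian. The term z = x is
added separately. -/
theorem summable_integral_norm_lower {A : Matrix (Fin d) (Fin d) ℝ} (hA : A.det ≠ 0) {s : ℂ}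
    (hs0 : 0 < s.re) (hs : (d : ℝ) / 2 < s.re) (x y : RSpace d) :
    Summable fun z : lattice A => ∫ t in Ioc (0 : ℝ) 1,
      ‖Complex.exp ((s - 1) * Real.log t) * modGaussian t x y z‖ := by
  simp only [exp_mul_modGaussian_eq, norm_mul, norm_exp_neg_I_mul_ofReal, one_mul]
  suffices h : Summable fun z : ↥(lattice A \ {x}) => ∫ t in Ioc (0 : ℝ) 1,
      ‖Complex.exp ((s - 1) * Real.log t -
        Real.pi * ((‖x - (z : RSpace d)‖ ^ 2 : ℝ) : ℂ) * t)‖ from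
    (hasSum_of_hasSum_sdiff_singleton (f := fun z : RSpace d => ∫ t in Ioc (0 : ℝ) 1,
      ‖Complex.exp ((s - 1) * Real.log t -
        Real.pi * ((‖x - z‖ ^ 2 : ℝ) : ℂ) * t)‖) h.hasSum).summable
  have h1 := (summable_lattice_norm_sub_rpow A hA (sdiff_subset (t := {x})) x
    (r := 2 * s.re) (by linarith)).mul_left (‖Complex.Gamma s.re‖ * Real.pi ^ (-s.re))
  have h2 := summable_upperGamma A hA (sdiff_subset (t := {x})) (s.re : ℂ) (x := x) (by simp)
  refine Summable.of_nonneg_of_le (fun z => integral_nonneg fun t => norm_nonneg _) (fun z => ?_)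
    (h1.add h2)
  have hzx : 0 < ‖x - (z : RSpace d)‖ := norm_pos_iff.2 (sub_ne_zero.2 fun h => z.2.2 h.symm)
  have hsr : 0 < ((s.re : ℝ) : ℂ).re := by simpa
  have h3 := eq_sub_of_add_eq' (upperGamma_add_integral_Ioc hsr (pow_pos hzx 2))
  rw [integral_norm_cexp_eq]
  have h4 : ∀ t : ℝ, (((s - 1) * Real.log t -
      Real.pi * ((‖x - (z : RSpace d)‖ ^ 2 : ℝ) : ℂ) * t).re : ℂ) =
      ((s.re : ℂ) - 1) * Real.log t - Real.pi * ((‖x - (z : RSpace d)‖ ^ 2 : ℝ) : ℂ) * t := by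
    intro t
    rw [← Complex.ofReal_mul, ← Complex.ofReal_mul]
    simp [-Complex.ofReal_mul, -Complex.ofReal_pow]
    push_cast
    rfl
  simp only [h4]
  rw [h3]
  refine (norm_sub_le _ _).trans (add_le_add_left (le_of_eq ?_) _)
  rw [ofReal_pi_mul_cpow_neg hzx, norm_mul, norm_mul, mul_assoc,
    Complex.norm_cpow_eq_rpow_re_of_pos Real.pi_pos, Complex.norm_cpow_eq_rpow_re_of_pos hzx,
    norm_sub_rev]
  simp

theorem hasSum_lowerTerm {A : Matrix (Fin d) (Fin d) ℝ} (hA : A.det ≠ 0) {s : ℂ}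
    (hs0 : 0 < s.re) (hs : (d : ℝ) / 2 < s.re) (x y : RSpace d) :
    HasSum (fun z : lattice A => lowerTerm s x y z)
      (∫ t in Ioc (0 : ℝ) 1,
        Complex.exp ((s - 1) * Real.log t) * ∑' z : lattice A, modGaussian t x y z) := by
  have hc : Countable (lattice A) := (countable_range _).to_subtype
  have h := hasSum_integral_of_summable_integral_norm (ι := lattice A)
    (F := fun z t => Complex.exp ((s - 1) * Real.log t) * modGaussian t x y z)
    (μ := volume.restrict (Ioc (0 : ℝ) 1)) (fun z => ?_)
    (summable_integral_norm_lower hA hs0 hs x y)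
  · simp only [tsum_mul_left] at h
    exact h
  · simp only [exp_mul_modGaussian_eq]
    exact (integrableOn_exp_log_Ioc hs0 _).const_mul _

theorem exp_mul_dual_eq (s : ℂ) (x y k : RSpace d) (t : ℝ) :
    Complex.exp ((s - 1) * Real.log t) * (Complex.exp (-(d / 2 : ℂ) * Real.log t) *
        Complex.exp (-(Real.pi * ((‖y - k‖ ^ 2 : ℝ) : ℂ) * (t⁻¹ : ℝ)) -
            2 * Real.pi * Complex.I * (inner ℝ (y - k) x : ℝ))) =
      Complex.exp (-(2 * Real.pi * Complex.I * (inner ℝ (y - k) x : ℝ))) *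
        Complex.exp ((s - d / 2 - 1) * Real.log t -
          Real.pi * ((‖y - k‖ ^ 2 : ℝ) : ℂ) * (t⁻¹ : ℝ)) := by
  rw [← Complex.exp_add, ← Complex.exp_add, ← Complex.exp_add]
  congr 1
  ring

theorem exp_mul_gammaTerm (s : ℂ) (x y k : RSpace d) :
    Complex.exp (-(2 * Real.pi * Complex.I * (inner ℝ (y - k) x : ℝ))) *
      upperGamma s ((‖y - k‖ ^ 2 : ℝ) : ℂ) =
    Complex.exp (-(2 * Real.pi * Complex.I * (inner ℝ x y : ℝ))) *
      gammaTerm k (s, ofRealVec y, ofRealVec x) := by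
  rw [gammaTerm]
  simp only [← ofRealVec_sub, bilin_self_ofRealVec, bilin_ofRealVec]
  rw [← mul_assoc, ← Complex.exp_add, inner_sub_left, real_inner_comm x k, real_inner_comm x y]
  congr 2
  push_cast
  ring

/-- Poisson summation is applied for each t. On the dual side sum and integral commute for every s,
since y off the reciprocal lattice makes all dual Gaussians decay as t → 0. -/
theorem integral_tsum_modGaussian {A : Matrix (Fin d) (Fin d) ℝ} (hA : A.det ≠ 0) (s : ℂ)
    (x : RSpace d) {y : RSpace d} (hy : y ∉ reciprocalLattice A) :
    ∫ t in Ioc (0 : ℝ) 1,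
        Complex.exp ((s - 1) * Real.log t) * ∑' z : lattice A, modGaussian t x y z =
      ((|A.det|⁻¹ : ℝ) : ℂ) * (Complex.exp (-(2 * Real.pi * Complex.I * (inner ℝ x y : ℝ))) *
        gammaSum (reciprocalLattice A) (d / 2 - s, ofRealVec y, ofRealVec x)) := by
  have hA' := det_inv_transpose_ne_zero hA
  have hc : Countable (reciprocalLattice A) := (countable_range _).to_subtype
  have hpos : ∀ k : reciprocalLattice A, 0 < ‖y - (k : RSpace d)‖ ^ 2 := fun k =>
    pow_pos (norm_pos_iff.2 (sub_ne_zero.2 fun h => hy (by rw [h]; exact k.2))) 2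
  have hint : ∀ (a : ℂ) (k : reciprocalLattice A), ∫ t in Ioc (0 : ℝ) 1,
      Complex.exp ((a - 1) * Real.log t -
          Real.pi * ((‖y - (k : RSpace d)‖ ^ 2 : ℝ) : ℂ) * (t⁻¹ : ℝ)) =
      upperGamma (-a) ((‖y - (k : RSpace d)‖ ^ 2 : ℝ) : ℂ) := fun a k =>
    integral_Ioc_inv_eq_upperGamma _ _
  have h := hasSum_integral_of_summable_integral_norm (ι := reciprocalLattice A)
    (F := fun k t => Complex.exp (-(2 * Real.pi * Complex.I * (inner ℝ (y - k) x : ℝ))) *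
        Complex.exp ((s - d / 2 - 1) * Real.log t -
          Real.pi * ((‖y - (k : RSpace d)‖ ^ 2 : ℝ) : ℂ) * (t⁻¹ : ℝ)))
    (μ := volume.restrict (Ioc (0 : ℝ) 1))
    (fun k => (integrableOn_Ioc_inv _ (by simpa [-Complex.ofReal_pow] using hpos k)).const_mul _) ?_
  · have h1 := h.tsum_eq
    simp only [integral_const_mul, hint, exp_mul_gammaTerm, neg_sub] at h1
    rw [tsum_mul_left] at h1
    rw [gammaSum, h1, ← integral_const_mul]
    refine setIntegral_congr_fun measurableSet_Ioc fun t ht => ?_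
    simp only [← exp_mul_dual_eq]
    rw [tsum_modGaussian hA ht.1, tsum_mul_left, tsum_mul_left]
    ring
  · simp only [norm_mul, norm_exp_neg_I_mul_ofReal, one_mul, integral_norm_cexp_eq]
    refine (summable_upperGamma _ hA' Subset.rfl (d / 2 - s.re : ℂ) hy).congr fun k => ?_
    have h4 : ∀ t : ℝ, (((s - d / 2 - 1) * Real.log t -
        Real.pi * ((‖y - (k : RSpace d)‖ ^ 2 : ℝ) : ℂ) * (t⁻¹ : ℝ)).re : ℂ) =
        ((s.re - d / 2 : ℂ) - 1) * Real.log t -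
          Real.pi * ((‖y - (k : RSpace d)‖ ^ 2 : ℝ) : ℂ) * (t⁻¹ : ℝ) := by
      intro t
      rw [← Complex.ofReal_mul, ← Complex.ofReal_mul]
      have : (d / 2 : ℂ) = ((d / 2 : ℝ) : ℂ) := by push_cast; rfl
      rw [this]
      simp [-Complex.ofReal_mul, -Complex.ofReal_pow, -Complex.ofReal_div, -Complex.ofReal_inv]
      push_cast
      rfl
    simp only [h4]
    refine congrArg _ (Eq.trans ?_ (hint (s.re - d / 2) k).symm)
    rw [neg_sub]

open Classical in
/-- The incomplete gamma function representation of the Epstein zeta function in the half-plane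
of absolute convergence. -/
theorem Gamma_mul_latticeSum {A : Matrix (Fin d) (Fin d) ℝ} (hA : A.det ≠ 0) {s : ℂ}
    (hs0 : 0 < s.re) (hs : (d : ℝ) / 2 < s.re) (x : RSpace d) {y : RSpace d}
    (hy : y ∉ reciprocalLattice A) :
    Complex.Gamma s * (Real.pi : ℂ) ^ (-s) * latticeSum A x y (2 * s) =
      gammaSum (lattice A \ {x}) (s, ofRealVec x, ofRealVec (-y)) +
      ((|A.det|⁻¹ : ℝ) : ℂ) * (Complex.exp (-(2 * Real.pi * Complex.I * (inner ℝ x y : ℝ))) *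
        gammaSum (reciprocalLattice A) (d / 2 - s, ofRealVec y, ofRealVec x)) -
      if x ∈ lattice A then
        Complex.exp (-(2 * Real.pi * Complex.I * (inner ℝ x y : ℝ))) / s else 0 := by
  have hL : lattice A \ {x} ⊆ lattice A := sdiff_subset
  have hlow := hasSum_lowerTerm hA hs0 hs x y
  rw [integral_tsum_modGaussian hA s x hy] at hlow
  have hsub : Summable fun z : ↥(lattice A \ {x}) => lowerTerm s x y (z : RSpace d) := by
    have h := hlow.summable.comp_injective (inclusion_injective hL)
    exact h
  have heq := hlow.unique (hasSum_of_hasSum_sdiff_singleton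
    (f := fun z : RSpace d => lowerTerm s x y z) hsub.hasSum)
  -- With w = 0 only the term n = 0 of the series survives, namely the integral 1/s of t^(s-1) over
  -- (0, 1).
  have hx : lowerTerm s x y x =
      Complex.exp (-(2 * Real.pi * Complex.I * (inner ℝ x y : ℝ))) / s := by
    simp only [lowerTerm, exp_mul_modGaussian_eq, sub_self, norm_zero]
    rw [integral_const_mul, integral_Ioc_eq_lowerGamma hs0, lowerGamma,
      tsum_univ fun n : ℕ => (-(Real.pi * (((0 : ℝ) ^ 2 : ℝ) : ℂ))) ^ n / (n.factorial * (s + n)),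
      tsum_eq_single 0 fun n hn => by simp [hn], real_inner_comm]
    simp [div_eq_mul_inv]
  rw [hx] at heq
  rw [heq, add_sub_assoc, add_sub_cancel_right, gammaSum, ← (summable_gammaTerm A hA hL
    (p := (s, ofRealVec x, ofRealVec (-y))) (ofRealVec_mem_coneDomain.2 (by simp))).tsum_add hsub,
    latticeSum, ← tsum_mul_left]
  refine tsum_congr fun z => ?_
  have hzx : 0 < ‖x - (z : RSpace d)‖ := norm_pos_iff.2 (sub_ne_zero.2 fun h => z.2.2 h.symm)
  have h1 := upperGamma_add_integral_Ioc hs0 (pow_pos hzx 2)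
  rw [ofReal_pi_mul_cpow_neg hzx] at h1
  have h2 : gammaTerm (z : RSpace d) (s, ofRealVec x, ofRealVec (-y)) =
      Complex.exp (-(2 * Real.pi * Complex.I * (inner ℝ y z : ℝ))) *
        upperGamma s ((‖x - (z : RSpace d)‖ ^ 2 : ℝ) : ℂ) := by
    rw [gammaTerm]
    simp only [← ofRealVec_sub, bilin_self_ofRealVec, bilin_ofRealVec, inner_neg_left,
      Complex.ofReal_neg, mul_neg]
  rw [h2, lowerTerm]
  simp only [exp_mul_modGaussian_eq]
  rw [integral_const_mul, ← mul_add, h1, Complex.cpow_neg _ (2 * s)]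
  simp only [neg_mul]
  ring

/-! ### The entire continuation of the Epstein zeta function -/

theorem differentiable_pi_cpow_half : Differentiable ℂ fun ν : ℂ => (Real.pi : ℂ) ^ (ν / 2) :=
  fun _ => DifferentiableAt.const_cpow (by fun_prop)
    (Or.inl (Complex.ofReal_ne_zero.2 Real.pi_ne_zero))

theorem differentiable_Gamma_inv_comp {E : Type*} [NormedAddCommGroup E] [NormedSpace ℂ E]
    {f : E → ℂ} (hf : Differentiable ℂ f) : Differentiable ℂ fun e => (Complex.Gamma (f e))⁻¹ :=
  Complex.differentiable_one_div_Gamma.comp hf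

theorem ofRealVec_neg (x : RSpace d) : ofRealVec (-x) = -ofRealVec x := by
  ext i; simp [ofRealVec]

open Classical in
/-- The representation of the Epstein zeta function by incomplete gamma functions. -/
noncomputable def entireZeta (A : Matrix (Fin d) (Fin d) ℝ) (x y : RSpace d) (ν : ℂ) : ℂ :=
  (Real.pi : ℂ) ^ (ν / 2) * (Complex.Gamma (ν / 2))⁻¹ *
      (gammaSum (lattice A \ {x}) (ν / 2, ofRealVec x, ofRealVec (-y)) +
      ((|A.det|⁻¹ : ℝ) : ℂ) * (Complex.exp (-(2 * Real.pi * Complex.I * (inner ℝ x y : ℝ))) *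
        gammaSum (reciprocalLattice A) ((d - ν) / 2, ofRealVec y, ofRealVec x))) -
      (if x ∈ lattice A then Complex.exp (-(2 * Real.pi * Complex.I * (inner ℝ x y : ℝ))) else 0) *
        ((Real.pi : ℂ) ^ (ν / 2) * (Complex.Gamma (ν / 2 + 1))⁻¹)

theorem differentiable_gammaSum_left (B : Matrix (Fin d) (Fin d) ℝ) (hB : B.det ≠ 0)
    {L : Set (RSpace d)} (hL : L ⊆ lattice B) {u : RSpace d} (hu : u ∉ L) (v : CSpace d)
    {f : ℂ → ℂ} (hf : Differentiable ℂ f) :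
    Differentiable ℂ fun ν => gammaSum L (f ν, ofRealVec u, v) := by
  rw [← differentiableOn_univ]
  exact (differentiableOn_gammaSum B hB hL).comp (f := fun ν => (f ν, ofRealVec u, v))
    (by fun_prop) (fun ν _ => ofRealVec_mem_coneDomain.2 hu)

theorem differentiable_entireZeta {A : Matrix (Fin d) (Fin d) ℝ} (hA : A.det ≠ 0) (x : RSpace d)
    {y : RSpace d} (hy : y ∉ reciprocalLattice A) : Differentiable ℂ (entireZeta A x y) := by
  have h1 := differentiable_gammaSum_left A hA (L := lattice A \ {x}) sdiff_subset (u := x)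
    (by simp) (ofRealVec (-y)) (f := fun ν => ν / 2) (by fun_prop)
  have h2 := differentiable_gammaSum_left _ (det_inv_transpose_ne_zero hA)
    (L := reciprocalLattice A) Subset.rfl hy (ofRealVec x) (f := fun ν => (d - ν) / 2)
    (by fun_prop)
  have h3 : Differentiable ℂ fun ν : ℂ => (Complex.Gamma (ν / 2))⁻¹ :=
    differentiable_Gamma_inv_comp (by fun_prop)
  have h4 : Differentiable ℂ fun ν : ℂ => (Complex.Gamma (ν / 2 + 1))⁻¹ :=
    differentiable_Gamma_inv_comp (by fun_prop)
  exact ((differentiable_pi_cpow_half.mul h3).mul (h1.add ((h2.const_mul _).const_mul _))).sub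
    ((differentiable_pi_cpow_half.mul h4).const_mul _)

theorem entireZeta_eq_latticeSum {A : Matrix (Fin d) (Fin d) ℝ} (hA : A.det ≠ 0) (x : RSpace d)
    {y : RSpace d} (hy : y ∉ reciprocalLattice A) {ν : ℂ} (hν : (d : ℝ) < ν.re) :
    entireZeta A x y ν = latticeSum A x y ν := by
  have hre : (ν / 2).re = ν.re / 2 := by simp
  have hd : (0 : ℝ) ≤ d := d.cast_nonneg
  have hs0 : 0 < (ν / 2).re := by rw [hre]; linarith
  have h3 := Gamma_mul_latticeSum hA hs0 (by rw [hre]; linarith) x hy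
  have hs : ν / 2 ≠ 0 := fun h => by simp [h] at hs0
  have hΓ : Complex.Gamma (ν / 2) ≠ 0 := Complex.Gamma_ne_zero_of_re_pos hs0
  have hπ : (Real.pi : ℂ) ^ (ν / 2) ≠ 0 := by
    simp [Complex.cpow_eq_zero_iff, Real.pi_ne_zero]
  rw [show 2 * (ν / 2) = ν by ring, show (d : ℂ) / 2 - ν / 2 = (d - ν) / 2 by ring,
    Complex.cpow_neg, eq_sub_iff_add_eq] at h3
  -- The correction for lattice points has the factor 1/(s Γ(s)) = 1/Γ(s + 1), which is entire.
  rw [entireZeta, ← h3, Complex.Gamma_add_one _ hs]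
  generalize ν / 2 = s at *
  split_ifs <;> field_simp <;> ring

theorem epsteinZeta_eq {A : Matrix (Fin d) (Fin d) ℝ} (hA : A.det ≠ 0) (ν : ℂ) (x : RSpace d)
    {y : RSpace d} (hy : y ∉ reciprocalLattice A) : epsteinZeta A ν x y = entireZeta A x y ν :=
  congrFun (meromorphicContinuation_eq (differentiable_entireZeta hA x hy)
    fun _ hν => entireZeta_eq_latticeSum hA x hy hν) ν

/-! ### The regularised function with complex arguments -/

/-- The regularised Epstein zeta function, up to the correction for lattice points `x`, as a
function of complex arguments. Here `L` are the lattice points over which the sum extends, and `R` is the regular part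
of the contribution of the origin of the reciprocal lattice. -/
noncomputable def complexReg (A : Matrix (Fin d) (Fin d) ℝ) (L : Set (RSpace d)) (R : ℂ → ℂ → ℂ)
    (p : ℂ × CSpace d × CSpace d) : ℂ :=
  (Real.pi : ℂ) ^ (p.1 / 2) * (Complex.Gamma (p.1 / 2))⁻¹ *
    (Complex.exp (2 * Real.pi * Complex.I * bilin p.2.1 p.2.2) *
      gammaSum L (p.1 / 2, p.2.1, -p.2.2) +
    ((|A.det|⁻¹ : ℝ) : ℂ) *
      (gammaSum (reciprocalLattice A \ {0}) ((d - p.1) / 2, p.2.2, p.2.1) +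
        R ((d - p.1) / 2) (bilin p.2.2 p.2.2)))

/-- S need not be open: a singleton S serves the exceptional exponents, where R is holomorphic only
in its second argument. -/
theorem differentiableOn_complexReg {A : Matrix (Fin d) (Fin d) ℝ} (hA : A.det ≠ 0)
    {L : Set (RSpace d)} (hL : L ⊆ lattice A) {R : ℂ → ℂ → ℂ} {S : Set ℂ}
    (hR : DifferentiableOn ℂ (fun q : ℂ × ℂ => R q.1 q.2)
      (((fun ν => ((d : ℂ) - ν) / 2) '' S) ×ˢ univ)) :
    DifferentiableOn ℂ (complexReg A L R)
      (S ×ˢ (coneDomain L ×ˢ coneDomain (reciprocalLattice A \ {0}))) := by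
  have hb1 : Differentiable ℂ fun p : ℂ × CSpace d × CSpace d => bilin p.2.1 p.2.2 :=
    differentiable_bilin (by fun_prop) (by fun_prop)
  have hb2 : Differentiable ℂ fun p : ℂ × CSpace d × CSpace d => bilin p.2.2 p.2.2 :=
    differentiable_bilin (by fun_prop) (by fun_prop)
  refine DifferentiableOn.mul (Differentiable.differentiableOn ?_)
    (DifferentiableOn.add (DifferentiableOn.mul (Differentiable.differentiableOn ?_) ?_)
      (DifferentiableOn.const_mul (DifferentiableOn.add ?_ ?_) _))
  · exact (differentiable_pi_cpow_half.comp differentiable_fst).mul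
      (differentiable_Gamma_inv_comp (by fun_prop))
  · exact (hb1.const_mul _).cexp
  · exact (differentiableOn_gammaSum A hA hL).comp
      (f := fun p : ℂ × CSpace d × CSpace d => (p.1 / 2, p.2.1, -p.2.2))
      (by fun_prop) (fun p hp => hp.2.1)
  · exact (differentiableOn_gammaSum _ (det_inv_transpose_ne_zero hA)
      (L := reciprocalLattice A \ {0}) sdiff_subset).comp
      (f := fun p : ℂ × CSpace d × CSpace d => ((d - p.1) / 2, p.2.2, p.2.1))
      (by fun_prop) (fun p hp => hp.2.2)
  · have h1 : Differentiable ℂ fun p : ℂ × CSpace d × CSpace d => ((d : ℂ) - p.1) / 2 := by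
      fun_prop
    exact hR.comp (f := fun p : ℂ × CSpace d × CSpace d => ((d - p.1) / 2, bilin p.2.2 p.2.2))
      (h1.prodMk hb2).differentiableOn (fun p hp => ⟨mem_image_of_mem _ hp.1, mem_univ _⟩)

/-- Separates the origin of the reciprocal lattice, the only term that is singular at y = 0. -/
theorem gammaSum_reciprocal_eq {A : Matrix (Fin d) (Fin d) ℝ} (hA : A.det ≠ 0) (s : ℂ)
    (x : RSpace d) {y : RSpace d} (hy : y ∉ reciprocalLattice A) :
    gammaSum (reciprocalLattice A) (s, ofRealVec y, ofRealVec x) =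
      gammaSum (reciprocalLattice A \ {0}) (s, ofRealVec y, ofRealVec x) +
        upperGamma s ((‖y‖ ^ 2 : ℝ) : ℂ) := by
  have h := hasSum_of_hasSum_sdiff_singleton (x := (0 : RSpace d))
    (f := fun z => gammaTerm z (s, ofRealVec y, ofRealVec x))
    (summable_gammaTerm _ (det_inv_transpose_ne_zero hA) (L := reciprocalLattice A \ {0})
      (p := (s, ofRealVec y, ofRealVec x)) sdiff_subset
      (ofRealVec_mem_coneDomain.2 fun h => hy h.1)).hasSum
  rw [if_pos (show (0 : RSpace d) ∈ reciprocalLattice A from zero_mem_lattice _)] at h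
  have h0 : gammaTerm (0 : RSpace d) (s, ofRealVec y, ofRealVec x) =
      upperGamma s ((‖y‖ ^ 2 : ℝ) : ℂ) := by
    rw [gammaTerm]
    simp only [← ofRealVec_sub, bilin_self_ofRealVec, bilin_ofRealVec, inner_zero_right, sub_zero]
    simp
  rw [h0] at h
  exact h.tsum_eq

-- The phase e^(2πi x·y) cancels the one in front of the reciprocal sum. By `hR`, subtracting ŝ
-- replaces the upper gamma term of the origin by R, so generic and exceptional exponents differ
-- only in R.
open Classical in
theorem complexReg_ofRealVec {A : Matrix (Fin d) (Fin d) ℝ} (hA : A.det ≠ 0) {ν : ℂ}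
    (x : RSpace d) {y : RSpace d} (hy : y ∉ reciprocalLattice A) {R : ℂ → ℂ → ℂ}
    (hR : (Real.pi : ℂ) ^ (ν / 2) * (Complex.Gamma (ν / 2))⁻¹ *
      (upperGamma ((d - ν) / 2) ((‖y‖ ^ 2 : ℝ) : ℂ) - R ((d - ν) / 2) ((‖y‖ ^ 2 : ℝ) : ℂ)) =
        sHat ν y) :
    epsteinZetaRegAway A ν x y =
      complexReg A (lattice A \ {x}) R (ν, ofRealVec x, ofRealVec y) -
        if x ∈ lattice A then (Real.pi : ℂ) ^ (ν / 2) * (Complex.Gamma (ν / 2 + 1))⁻¹ else 0 := by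
  rw [epsteinZetaRegAway, epsteinZeta_eq hA ν x hy, entireZeta, gammaSum_reciprocal_eq hA _ x hy,
    complexReg, ← hR]
  simp only [bilin_self_ofRealVec, ← ofRealVec_neg]
  simp only [bilin_ofRealVec]
  have hE : Complex.exp (-(2 * Real.pi * Complex.I * (inner ℝ x y : ℝ))) =
      (Complex.exp (2 * Real.pi * Complex.I * (inner ℝ x y : ℝ)))⁻¹ := Complex.exp_neg _
  rw [hE]
  have hE0 := Complex.exp_ne_zero (2 * Real.pi * Complex.I * (inner ℝ x y : ℝ))
  generalize Complex.exp (2 * Real.pi * Complex.I * (inner ℝ x y : ℝ)) = E at hE0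
  push_cast
  split_ifs <;> field_simp <;> ring

theorem mem_exceptionalExponents_compl {ν : ℂ} :
    ν ∈ (exceptionalExponents d)ᶜ ↔ ∀ n : ℕ, (d - ν) / 2 + (n : ℂ) ≠ 0 := by
  simp only [exceptionalExponents, mem_compl_iff, mem_ofPred_eq, not_exists]
  refine forall_congr' fun n => not_congr ⟨fun h => ?_, fun h => ?_⟩
  · rw [h]; ring
  · linear_combination (-2) * h

theorem isOpen_exceptionalExponents_compl : IsOpen (exceptionalExponents d)ᶜ := by
  have h := (isOpen_forall_add_natCast_ne univ).preimage
    (f := fun ν : ℂ => ((d : ℂ) - ν) / 2) (by fun_prop)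
  convert h using 1
  ext ν
  rw [mem_exceptionalExponents_compl]
  simp

/-- The regular part of the contribution of the origin for generic exponents. -/
theorem sHat_generic_eq {ν : ℂ} (hν : ν ∉ exceptionalExponents d) {y : RSpace d} (hy : y ≠ 0) :
    (Real.pi : ℂ) ^ (ν / 2) * (Complex.Gamma (ν / 2))⁻¹ *
      (upperGamma ((d - ν) / 2) ((‖y‖ ^ 2 : ℝ) : ℂ) -
        -lowerGamma univ ((d - ν) / 2) ((‖y‖ ^ 2 : ℝ) : ℂ)) = sHat ν y := by
  rw [sHat, dif_neg (show ¬∃ k : ℕ, ν = d + 2 * k from hν), sHatGeneric, sub_neg_eq_add,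
    upperGamma_add_lowerGamma (mem_exceptionalExponents_compl.1 hν) (pow_pos (norm_pos_iff.2 hy) 2),
    show -(((d : ℂ) - ν) / 2) = (ν - d) / 2 by ring]
  ring

/-- The chosen ŝ keeps only the logarithmic part; the leftover c (πw)^k is a polynomial and goes
into the regular part. -/
theorem sHat_exceptional_eq (k : ℕ) : ∃ c : ℂ, ∀ y : RSpace d, y ≠ 0 →
    (Real.pi : ℂ) ^ (((d : ℂ) + 2 * k) / 2) * (Complex.Gamma (((d : ℂ) + 2 * k) / 2))⁻¹ *
      (upperGamma ((d - ((d : ℂ) + 2 * k)) / 2) ((‖y‖ ^ 2 : ℝ) : ℂ) -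
        ((Real.pi * ((‖y‖ ^ 2 : ℝ) : ℂ)) ^ k * c -
          lowerGamma {k}ᶜ (-k) ((‖y‖ ^ 2 : ℝ) : ℂ))) = sHat ((d : ℂ) + 2 * k) y := by
  obtain ⟨c, hc⟩ := exists_upperGamma_neg_natCast k
  refine ⟨c, fun y hy => ?_⟩
  have h := hc (‖y‖ ^ 2) (pow_pos (norm_pos_iff.2 hy) 2)
  have hex : ∃ j : ℕ, (d : ℂ) + 2 * k = d + 2 * j := ⟨k, rfl⟩
  have hk : hex.choose = k := by
    have h1 := hex.choose_spec
    have h2 : (k : ℂ) = hex.choose := by linear_combination h1 / 2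
    exact_mod_cast h2.symm
  rw [sHat, dif_pos hex, hk, sHatExceptional,
    show ((d : ℂ) - (d + 2 * k)) / 2 = -k by ring, show ((d : ℂ) + 2 * k) / 2 = k + d / 2 by ring,
    eq_sub_of_add_eq h]
  push_cast
  ring

/-- A holomorphic extension of the unregularised values also gives the value at the origin. -/
theorem eq_epsteinZetaReg_of_continuousOn (hd : 0 < d) {A : Matrix (Fin d) (Fin d) ℝ}
    (hA : A.det ≠ 0) {ν : ℂ} {x : RSpace d} {F : CSpace d → ℂ}
    (hF : ContinuousOn F (coneDomain (reciprocalLattice A \ {0})))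
    (h : ∀ y ∉ reciprocalLattice A, F (ofRealVec y) = epsteinZetaRegAway A ν x y) {y : RSpace d}
    (hy : y ∉ reciprocalLattice A \ {0}) : F (ofRealVec y) = epsteinZetaReg A ν x y := by
  rw [epsteinZetaReg]
  split_ifs with hy0
  · subst hy0
    have : Nonempty (Fin d) := ⟨⟨0, hd⟩⟩
    -- Positive dimension enters here: the punctured neighbourhood of 0 is nontrivial, so the limit
    -- defining the value at 0 is unique.
    have : NeBot (𝓝[{0}ᶜ] (0 : RSpace d)) := Module.punctured_nhds_neBot ℝ (RSpace d) 0
    have ho : IsOpen (coneDomain (reciprocalLattice A \ {0})) :=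
      isOpen_coneDomain _ (det_inv_transpose_ne_zero hA) sdiff_subset
    have hmem : ofRealVec (0 : RSpace d) ∈ coneDomain (reciprocalLattice A \ {0}) :=
      ofRealVec_mem_coneDomain.2 hy
    have hlim : Tendsto (fun y : RSpace d => F (ofRealVec y)) (𝓝[{0}ᶜ] 0)
        (𝓝 (F (ofRealVec (0 : RSpace d)))) :=
      ((hF.continuousAt (ho.mem_nhds hmem)).tendsto.comp
        continuous_ofRealVec.continuousAt.tendsto).mono_left nhdsWithin_le_nhds
    have hev : (fun y : RSpace d => F (ofRealVec y)) =ᶠ[𝓝[{0}ᶜ] 0] epsteinZetaRegAway A ν x := by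
      filter_upwards [mem_nhdsWithin_of_mem_nhds
        (continuous_ofRealVec.continuousAt.preimage_mem_nhds (ho.mem_nhds hmem)), self_mem_nhdsWithin] with z hz hz0
      exact h z fun hzA => ofRealVec_mem_coneDomain.1 hz ⟨hzA, hz0⟩
    exact (hlim.congr' hev).limUnder_eq.symm
  · exact h y fun hyA => hy ⟨hyA, hy0⟩

theorem differentiableOn_neg_lowerGamma :
    DifferentiableOn ℂ (fun q : ℂ × ℂ => -lowerGamma univ q.1 q.2)
      (((fun ν => ((d : ℂ) - ν) / 2) '' (exceptionalExponents d)ᶜ) ×ˢ univ) := by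
  refine (differentiableOn_lowerGamma univ).neg.mono ?_
  rintro ⟨s, w⟩ ⟨⟨ν, hν, rfl⟩, -⟩ n -
  exact mem_exceptionalExponents_compl.1 hν n

/-- The regularised Epstein zeta function for `x` outside of the lattice and generic exponents. -/
theorem complexReg_eq_generic (hd : 0 < d) {A : Matrix (Fin d) (Fin d) ℝ} (hA : A.det ≠ 0) {ν : ℂ}
    (hν : ν ∉ exceptionalExponents d) {x : RSpace d} (hx : x ∉ lattice A) {y : RSpace d}
    (hy : y ∉ reciprocalLattice A \ {0}) :
    complexReg A (lattice A) (fun s w => -lowerGamma univ s w) (ν, ofRealVec x, ofRealVec y) =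
      epsteinZetaReg A ν x y := by
  refine eq_epsteinZetaReg_of_continuousOn hd hA
    (F := fun u => complexReg A (lattice A) (fun s w => -lowerGamma univ s w) (ν, ofRealVec x, u))
    ?_ (fun y hy => ?_) hy
  · exact (differentiableOn_complexReg hA Subset.rfl
      differentiableOn_neg_lowerGamma).continuousOn.comp
      (by fun_prop) fun u hu => ⟨hν, ofRealVec_mem_coneDomain.2 hx, hu⟩
  · have hy0 : y ≠ 0 := fun h => hy (h ▸ zero_mem_lattice _)
    rw [complexReg_ofRealVec hA x hy (R := fun s w => -lowerGamma univ s w)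
      (sHat_generic_eq hν hy0), if_neg hx, sub_zero, sdiff_singleton_eq_self hx]

/-- The regularised Epstein zeta function for lattice points `x` and generic exponents. -/
theorem complexReg_eq_lattice (hd : 0 < d) {A : Matrix (Fin d) (Fin d) ℝ} (hA : A.det ≠ 0) {ν : ℂ}
    (hν : ν ∉ exceptionalExponents d) {x : RSpace d} (hx : x ∈ lattice A) {y : RSpace d}
    (hy : y ∉ reciprocalLattice A \ {0}) :
    complexReg A (lattice A \ {x}) (fun s w => -lowerGamma univ s w)
      (ν, ofRealVec x, ofRealVec y) - (Real.pi : ℂ) ^ (ν / 2) * (Complex.Gamma (ν / 2 + 1))⁻¹ =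
      epsteinZetaReg A ν x y := by
  refine eq_epsteinZetaReg_of_continuousOn hd hA
    (F := fun u => complexReg A (lattice A \ {x}) (fun s w => -lowerGamma univ s w)
      (ν, ofRealVec x, u) - (Real.pi : ℂ) ^ (ν / 2) * (Complex.Gamma (ν / 2 + 1))⁻¹)
    (ContinuousOn.sub ?_ continuousOn_const) (fun y hy => ?_) hy
  · exact (differentiableOn_complexReg hA sdiff_subset
      differentiableOn_neg_lowerGamma).continuousOn.comp
      (by fun_prop) fun u hu => ⟨hν, ofRealVec_mem_coneDomain.2 (by simp), hu⟩
  · have hy0 : y ≠ 0 := fun h => hy (h ▸ zero_mem_lattice _)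
    rw [complexReg_ofRealVec hA x hy (R := fun s w => -lowerGamma univ s w)
      (sHat_generic_eq hν hy0), if_pos hx]

/-- Joint holomorphy for generic exponents. -/
theorem exists_holomorphic_generic (hd : 0 < d) {A : Matrix (Fin d) (Fin d) ℝ} (hA : A.det ≠ 0) :
    ∃ F : ℂ × CSpace d × CSpace d → ℂ,
      IsHolomorphicOn F ((exceptionalExponents d)ᶜ ×ˢ
        (coneDomain (lattice A) ×ˢ coneDomain (reciprocalLattice A \ {0}))) ∧
      ∀ ν ∉ exceptionalExponents d, ∀ x ∉ lattice A, ∀ y ∉ reciprocalLattice A \ {0},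
        F (ν, ofRealVec x, ofRealVec y) = epsteinZetaReg A ν x y :=
  ⟨complexReg A (lattice A) fun s w => -lowerGamma univ s w,
    ⟨isOpen_exceptionalExponents_compl.prod ((isOpen_coneDomain A hA Subset.rfl).prod
      (isOpen_coneDomain _ (det_inv_transpose_ne_zero hA) sdiff_subset)),
      differentiableOn_complexReg hA Subset.rfl differentiableOn_neg_lowerGamma⟩,
    fun _ hν _ hx _ hy => complexReg_eq_generic hd hA hν hx hy⟩

/-- Joint holomorphy for a fixed exceptional exponent. -/
theorem exists_holomorphic_exceptional (hd : 0 < d) {A : Matrix (Fin d) (Fin d) ℝ}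
    (hA : A.det ≠ 0) {ν : ℂ} (hν : ν ∈ exceptionalExponents d) :
    ∃ F : CSpace d × CSpace d → ℂ,
      IsHolomorphicOn F (coneDomain (lattice A) ×ˢ coneDomain (reciprocalLattice A \ {0})) ∧
      ∀ x ∉ lattice A, ∀ y ∉ reciprocalLattice A \ {0},
        F (ofRealVec x, ofRealVec y) = epsteinZetaReg A ν x y := by
  obtain ⟨k, rfl⟩ := hν
  obtain ⟨c, hc⟩ := sHat_exceptional_eq (d := d) k
  -- R ignores its first argument, which is frozen at (d - ν)/2 = -k.
  set R : ℂ → ℂ → ℂ := fun _ w => (Real.pi * w) ^ k * c - lowerGamma {k}ᶜ (-k) w with hR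
  have hRd : DifferentiableOn ℂ (fun q : ℂ × ℂ => R q.1 q.2)
      (((fun ν => ((d : ℂ) - ν) / 2) '' {(d : ℂ) + 2 * k}) ×ˢ univ) := by
    refine DifferentiableOn.sub (by fun_prop) ?_
    refine (differentiableOn_lowerGamma {k}ᶜ).comp (f := fun q : ℂ × ℂ => (-(k : ℂ), q.2))
      (by fun_prop) fun q _ n hn h0 => ?_
    rw [neg_add_eq_zero] at h0
    exact hn (by exact_mod_cast h0.symm)
  have hdiff : DifferentiableOn ℂ
      (fun q : CSpace d × CSpace d => complexReg A (lattice A) R ((d : ℂ) + 2 * k, q))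
      (coneDomain (lattice A) ×ˢ coneDomain (reciprocalLattice A \ {0})) :=
    (differentiableOn_complexReg hA Subset.rfl hRd).comp (by fun_prop) fun q hq => ⟨rfl, hq⟩
  refine ⟨_, ⟨(isOpen_coneDomain A hA Subset.rfl).prod
    (isOpen_coneDomain _ (det_inv_transpose_ne_zero hA) sdiff_subset), hdiff⟩,
    fun x hx y hy => ?_⟩
  refine eq_epsteinZetaReg_of_continuousOn hd hA
    (F := fun u => complexReg A (lattice A) R ((d : ℂ) + 2 * k, ofRealVec x, u))
    (hdiff.continuousOn.comp (f := fun u => (ofRealVec x, u)) (by fun_prop)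
      fun u hu => ⟨ofRealVec_mem_coneDomain.2 hx, hu⟩) (fun y hy => ?_) hy
  have hy0 : y ≠ 0 := fun h => hy (h ▸ zero_mem_lattice _)
  rw [complexReg_ofRealVec hA x hy (R := R) (hc y hy0), if_neg hx, sub_zero,
    sdiff_singleton_eq_self hx]

/-- Joint holomorphy for a fixed lattice point. -/
theorem exists_holomorphic_lattice (hd : 0 < d) {A : Matrix (Fin d) (Fin d) ℝ} (hA : A.det ≠ 0)
    {x : RSpace d} (hx : x ∈ lattice A) :
    ∃ F : ℂ × CSpace d → ℂ,
      IsHolomorphicOn F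
        ((exceptionalExponents d)ᶜ ×ˢ coneDomain (reciprocalLattice A \ {0})) ∧
      ∀ ν ∉ exceptionalExponents d, ∀ y ∉ reciprocalLattice A \ {0},
        F (ν, ofRealVec y) = epsteinZetaReg A ν x y := by
  refine ⟨fun q => complexReg A (lattice A \ {x}) (fun s w => -lowerGamma univ s w)
      (q.1, ofRealVec x, q.2) - (Real.pi : ℂ) ^ (q.1 / 2) * (Complex.Gamma (q.1 / 2 + 1))⁻¹,
    ⟨isOpen_exceptionalExponents_compl.prod
      (isOpen_coneDomain _ (det_inv_transpose_ne_zero hA) sdiff_subset), ?_⟩,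
    fun ν hν y hy => complexReg_eq_lattice hd hA hν hx hy⟩
  refine DifferentiableOn.sub ?_ (Differentiable.differentiableOn ?_)
  · exact (differentiableOn_complexReg hA sdiff_subset differentiableOn_neg_lowerGamma).comp
      (f := fun q : ℂ × CSpace d => (q.1, ofRealVec x, q.2)) (by fun_prop)
      fun q hq => ⟨hq.1, ofRealVec_mem_coneDomain.2 (by simp), hq.2⟩
  · exact (differentiable_pi_cpow_half.comp differentiable_fst).mul
      (differentiable_Gamma_inv_comp (by fun_prop))

/-! ### Fixed exponent and x: reciprocal cell and Brillouin zone -/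

theorem exists_holomorphic_reciprocal (hd : 0 < d) {A : Matrix (Fin d) (Fin d) ℝ}
    (hA : A.det ≠ 0) {ν : ℂ} {x : RSpace d} (h : ν ∉ exceptionalExponents d ∨ x ∉ lattice A) :
    ∃ G : CSpace d → ℂ, IsHolomorphicOn G (coneDomain (reciprocalLattice A \ {0})) ∧
      ∀ y ∉ reciprocalLattice A \ {0}, G (ofRealVec y) = epsteinZetaReg A ν x y := by
  have ho : IsOpen (coneDomain (reciprocalLattice A \ {0})) :=
    isOpen_coneDomain _ (det_inv_transpose_ne_zero hA) sdiff_subset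
  by_cases hx : x ∈ lattice A
  · have hν := h.resolve_right (not_not.2 hx)
    obtain ⟨F, hF, hFe⟩ := exists_holomorphic_lattice hd hA hx
    exact ⟨fun u => F (ν, u), ⟨ho, hF.2.comp (by fun_prop) fun u hu => ⟨hν, hu⟩⟩,
      fun y hy => hFe ν hν y hy⟩
  have hx' := ofRealVec_mem_coneDomain.2 hx
  by_cases hν : ν ∈ exceptionalExponents d
  · obtain ⟨F, hF, hFe⟩ := exists_holomorphic_exceptional hd hA hν
    exact ⟨fun u => F (ofRealVec x, u), ⟨ho, hF.2.comp (by fun_prop) fun u hu => ⟨hx', hu⟩⟩,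
      fun y hy => hFe x hx y hy⟩
  · obtain ⟨F, hF, hFe⟩ := exists_holomorphic_generic hd hA
    exact ⟨fun u => F (ν, ofRealVec x, u),
      ⟨ho, hF.2.comp (by fun_prop) fun u hu => ⟨hν, hx', hu⟩⟩, fun y hy => hFe ν hν x hx y hy⟩

/-- Integer coordinates in [-1/2, 1/2) vanish. -/
theorem notMem_reciprocalLattice_of_mem_cell {A : Matrix (Fin d) (Fin d) ℝ} (hA : A.det ≠ 0)
    {y : RSpace d} (hy : y ∈ reciprocalCell A) : y ∉ reciprocalLattice A \ {0} := by
  rintro ⟨⟨n, hn⟩, hy0⟩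
  obtain ⟨t, ht, rfl⟩ := hy
  have h1 := Matrix.mulVec_injective_of_det_ne_zero (det_inv_transpose_ne_zero hA)
    (WithLp.toLp_injective 2 hn)
  have h2 : t = 0 := by
    ext i
    have h3 : (n i : ℝ) = t i := congrFun h1 i
    have h4 := ht i
    rw [← h3] at h4 ⊢
    have h5 : (-1 : ℝ) < n i := by linarith [h4.1]
    have h6 : (n i : ℝ) < 1 := by linarith [h4.2]
    have h5' : -1 < n i := by exact_mod_cast h5
    have h6' : n i < 1 := by exact_mod_cast h6
    have : n i = 0 := by omega
    simp [this]
  exact hy0 (by simp [h2])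

/-- Test the defining inequality with k = y. -/
theorem notMem_reciprocalLattice_of_mem_brillouinZone {A : Matrix (Fin d) (Fin d) ℝ}
    {y : RSpace d} (hy : y ∈ brillouinZone A) : y ∉ reciprocalLattice A \ {0} := by
  rintro ⟨hyA, hy0⟩
  have h := hy y hyA
  rw [sub_self, norm_zero] at h
  exact hy0 (norm_le_zero_iff.1 h)

end Epstein

theorem mainTheorem5 (d : ℕ) (hd : 0 < d) (A : Matrix (Fin d) (Fin d) ℝ) (hA : A.det ≠ 0) :
    (∃ F : ℂ × Epstein.CSpace d × Epstein.CSpace d → ℂ,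
      Epstein.IsHolomorphicOn F
        ((Epstein.exceptionalExponents d)ᶜ ×ˢ
          (Epstein.coneDomain (Epstein.lattice A) ×ˢ
            Epstein.coneDomain (Epstein.reciprocalLattice A \ {0}))) ∧
      ∀ ν ∉ Epstein.exceptionalExponents d, ∀ x ∉ Epstein.lattice A,
        ∀ y ∉ Epstein.reciprocalLattice A \ {0},
          F (ν, Epstein.ofRealVec x, Epstein.ofRealVec y) = Epstein.epsteinZetaReg A ν x y) ∧
    (∀ ν ∈ Epstein.exceptionalExponents d,
      ∃ F : Epstein.CSpace d × Epstein.CSpace d → ℂ,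
        Epstein.IsHolomorphicOn F
          (Epstein.coneDomain (Epstein.lattice A) ×ˢ
            Epstein.coneDomain (Epstein.reciprocalLattice A \ {0})) ∧
        ∀ x ∉ Epstein.lattice A, ∀ y ∉ Epstein.reciprocalLattice A \ {0},
          F (Epstein.ofRealVec x, Epstein.ofRealVec y) = Epstein.epsteinZetaReg A ν x y) ∧
    (∀ x ∈ Epstein.lattice A,
      ∃ F : ℂ × Epstein.CSpace d → ℂ,
        Epstein.IsHolomorphicOn F
          ((Epstein.exceptionalExponents d)ᶜ ×ˢ
            Epstein.coneDomain (Epstein.reciprocalLattice A \ {0})) ∧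
        ∀ ν ∉ Epstein.exceptionalExponents d, ∀ y ∉ Epstein.reciprocalLattice A \ {0},
          F (ν, Epstein.ofRealVec y) = Epstein.epsteinZetaReg A ν x y) ∧
    (∀ (ν : ℂ) (x : Epstein.RSpace d),
      ν ∉ Epstein.exceptionalExponents d ∨ x ∉ Epstein.lattice A →
      ∃ (U : Set (Epstein.CSpace d)) (G : Epstein.CSpace d → ℂ),
        Epstein.ofRealVec '' (Epstein.reciprocalCell A ∪ Epstein.brillouinZone A) ⊆ U ∧
        Epstein.IsHolomorphicOn G U ∧
        ∀ y : Epstein.RSpace d, Epstein.ofRealVec y ∈ U →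
          G (Epstein.ofRealVec y) = Epstein.epsteinZetaReg A ν x y) := by
  refine ⟨Epstein.exists_holomorphic_generic hd hA,
    fun ν hν => Epstein.exists_holomorphic_exceptional hd hA hν,
    fun x hx => Epstein.exists_holomorphic_lattice hd hA hx, fun ν x h => ?_⟩
  obtain ⟨G, hG, hGe⟩ := Epstein.exists_holomorphic_reciprocal hd hA h
  -- The neighbourhood is the whole cone domain; at real points its condition only says that y is no
  -- nonzero reciprocal lattice point.
  refine ⟨_, G, ?_, hG, fun y hy => hGe y (Epstein.ofRealVec_mem_coneDomain.1 hy)⟩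
  rintro _ ⟨y, hy, rfl⟩
  refine Epstein.ofRealVec_mem_coneDomain.2 ?_
  exact hy.elim (Epstein.notMem_reciprocalLattice_of_mem_cell hA)
    Epstein.notMem_reciprocalLattice_of_mem_brillouinZone
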